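/- \textbf{Proposition (Comparison of two codes based on the packet error probability).} Let $M, m \ge 0$ and $n \ge 1$ be integers and let $A \in \mathbb{R}^{M\times n}$, $B \in \mathbb{R}^{M\times m}$ be code matrices: the $i$-th row of $A$ (of $B$) is the codeword that the block code $\mathcal{A}$ (respectively $\mathcal{B}$) assigns to the message $i \in \{1,\dots,M\}$. Both codes are used over an additive white Gaussian noise channel with known noise variance $\sigma^2 > 0$, so that the code $\mathcal{A}$ is the linear normal experiment $\mathcal{E}(A,\sigma^2 I)$ with parameter $\beta \in \mathbb{R}^M$ and observation $z \sim N(A'\beta, \sigma^2 I)$, and likewise for $\mathcal{B}$; message $i$ corresponds to $\beta = e_i$. A decoder is a measurable map $d$ from the received vectors to $\{1,\dots,M\}$, and its packet error probability at message $e_i$ is $P_e(e_i) = \Pr[d(z) \ne i \mid \beta = e_i]$. For experiments $\mathcal{E} = (P_\theta)_{\theta\in\Theta}$ and $\mathcal{F} = (Q_\theta)_{\theta\in\Theta}$, the Le Cam deficiency $\delta(\mathcal{E},\mathcal{F})$ is the infimum of all $\varepsilon \ge 0$ such that for every $\Theta_0 \subseteq \Theta$, every decision space, every real-valued loss function $L(\theta,y)$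 that is bounded and measurable in $y$, and every (randomized) decision rule $\rho$ of $\mathcal{F}$ there is a (randomized) decision rule $\tau$ of $\mathcal{E}$ with $$\int\!\!\int L(\theta,y)\,\tau(dy\mid x)\,P_\theta(dx) \le \int\!\!\int L(\theta,y)\,\rho(dy\mid x)\,Q_\theta(dx) + \varepsilon \sup_y |L(\theta,y)| \qquad (\theta \in \Theta_0).$$ (a) If $AA' - BB'$ is positive semidefinite, then for every decoder of $\mathcal{B}$ there is a decoder of $\mathcal{A}$ such that $$P_e^{\mathcal{A}}(e_i) \le P_e^{\mathcal{B}}(e_i) \quad\text{for every } i = 1,\dots,M.$$ (b) If $\mathrm{range}(B) \subseteq \mathrm{range}(A)$ (column spaces), then for every decoder of $\mathcal{B}$ there is a decoder of $\mathcal{A}$ such that $$P_e^{\mathcal{A}}(e_i) - P_e^{\mathcal{B}}(e_i) \le \delta(\mathcal{A},\mathcal{B}) \quad\text{for every } i = 1,\dots,M,$$ and $$\delta(\mathcal{A},\mathcal{B}) = \bigl\| N\bigl(0,\, (B'(AA')^{+}B) \vee I\bigr) - N(0, I) \bigr\| .$$ Here $(AA')^{+}$ is the Moore--Penrose pseudoinverse;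 for a symmetric matrix $S = U\,\mathrm{diag}(\lambda_1,\dots,\lambda_m)\,U'$ with $U$ orthogonal, $S \vee I = U\,\mathrm{diag}(\max(\lambda_1,1),\dots,\max(\lambda_m,1))\,U'$; and $\|P-Q\| = \int |p(x)-q(x)|\,dx$ is the total variation norm of the difference of two distributions with densities $p$ and $q$. -/

import Mathlib

open MeasureTheory ProbabilityTheory

namespace CodeComparison

/-! ### Matrices -/

/-- The four Penrose equations: `X` is the Moore-Penrose pseudoinverse of the real matrix `A`. -/
structure IsMoorePenrose {m n : ℕ} (A : Matrix (Fin m) (Fin n) ℝ)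
    (X : Matrix (Fin n) (Fin m) ℝ) : Prop where
  mul_mul_left : A * X * A = A
  mul_mul_right : X * A * X = X
  symm_left : (A * X).transpose = A * X
  symm_right : (X * A).transpose = X * A

/-- Every real matrix has a Moore-Penrose pseudoinverse. -/
theorem exists_isMoorePenrose {m n : ℕ} (A : Matrix (Fin m) (Fin n) ℝ) :
    ∃ X, IsMoorePenrose A X := by
  have hS : IsSelfAdjoint (A.transpose * A) := by
    have h := Matrix.isHermitian_conjTranspose_mul_self A
    rw [Matrix.conjTranspose_eq_transpose_of_trivial] at h
    exact h
  obtain ⟨S, hSdef⟩ : ∃ S, S = A.transpose * A := ⟨_, rfl⟩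
  rw [← hSdef] at hS
  obtain ⟨P, hP⟩ : ∃ P, P = cfc (fun x : ℝ => x⁻¹) S := ⟨_, rfl⟩
  have hc : ∀ f : ℝ → ℝ, ContinuousOn f (spectrum ℝ S) := fun f => by
    have : Finite (spectrum ℝ S) := Matrix.finite_real_spectrum
    exact (Set.toFinite (spectrum ℝ S)).continuousOn f
  have hid : cfc (fun x : ℝ => x) S = S := cfc_id' ℝ S
  have hSP : S * P = cfc (fun x : ℝ => x * x⁻¹) S := by
    rw [hP, cfc_mul (fun x : ℝ => x) (fun x : ℝ => x⁻¹) S (hc _) (hc _), hid]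
  have hPS : P * S = cfc (fun x : ℝ => x⁻¹ * x) S := by
    rw [hP, cfc_mul (fun x : ℝ => x⁻¹) (fun x : ℝ => x) S (hc _) (hc _), hid]
  have hcomm : S * P = P * S := by
    rw [hSP, hPS]; simp only [mul_comm]
  have hSPS : S * P * S = S := by
    have h := cfc_mul (fun x : ℝ => x * x⁻¹) (fun x : ℝ => x) S (hc _) (hc _)
    rw [← hSP, hid] at h
    rw [← h]
    simp only [mul_inv_mul_cancel]
    exact hid
  have hPSP : P * S * P = P := by
    have h := cfc_mul (fun x : ℝ => x⁻¹ * x) (fun x : ℝ => x⁻¹) S (hc _) (hc _)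
    rw [← hPS, ← hP] at h
    rw [← h, hP]
    congr 1
    funext x
    simpa using mul_inv_mul_cancel (x⁻¹)
  have hPt : P.transpose = P := by
    have h : IsSelfAdjoint P := by rw [hP]; exact IsSelfAdjoint.cfc
    have h2 : P.conjTranspose = P := h
    rwa [Matrix.conjTranspose_eq_transpose_of_trivial] at h2
  have hSt : S.transpose = S := by
    rw [hSdef]; simp [Matrix.transpose_mul]
  have hA : A * (P * S - 1) = 0 := by
    rw [← Matrix.conjTranspose_mul_self_eq_zero, Matrix.conjTranspose_eq_transpose_of_trivial,
      Matrix.transpose_mul]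
    have e : (P * S - 1).transpose * A.transpose * (A * (P * S - 1))
        = (S * P * S - S) * (P * S - 1) := by
      have e1 : (P * S - 1).transpose = S * P - 1 := by
        simp [Matrix.transpose_sub, Matrix.transpose_mul, hPt, hSt]
      rw [e1]
      calc (S * P - 1) * A.transpose * (A * (P * S - 1))
          = (S * P - 1) * (A.transpose * A) * (P * S - 1) := by simp only [Matrix.mul_assoc]
        _ = _ := by rw [← hSdef, sub_mul (S * P) 1 S, one_mul]
    rw [e, hSPS, sub_self, zero_mul]
  refine ⟨P * A.transpose, ?_, ?_, ?_, ?_⟩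
  · have h : A * (P * A.transpose) * A = A * (P * S) := by
      rw [hSdef]; simp only [Matrix.mul_assoc]
    rw [h]
    have h2 : A * (P * S) - A = 0 := by
      rw [Matrix.mul_sub, Matrix.mul_one] at hA
      exact hA
    exact sub_eq_zero.mp h2
  · calc P * A.transpose * A * (P * A.transpose)
        = P * (A.transpose * A) * P * A.transpose := by simp only [Matrix.mul_assoc]
      _ = P * A.transpose := by rw [← hSdef, hPSP]
  · simp [Matrix.transpose_mul, hPt, Matrix.mul_assoc]
  · have h : P * A.transpose * A = P * S := by rw [hSdef, Matrix.mul_assoc]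
    rw [h, Matrix.transpose_mul, hPt, hSt, hcomm]

/-- The Moore-Penrose pseudoinverse `A⁺`. -/
noncomputable def pinv {m n : ℕ} (A : Matrix (Fin m) (Fin n) ℝ) : Matrix (Fin n) (Fin m) ℝ :=
  (exists_isMoorePenrose A).choose

theorem pinv_spec {m n : ℕ} (A : Matrix (Fin m) (Fin n) ℝ) : IsMoorePenrose A (pinv A) :=
  (exists_isMoorePenrose A).choose_spec

/-- `S ∨ I` for a symmetric matrix `S`: the maximum is taken entrywise after both commuting
matrices have been diagonalised in an orthonormal eigenbasis of `S`, so that every eigenvalue `t`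
of `S` becomes `max t 1` (see `supOne_eq`). -/
noncomputable def supOne {m : ℕ} (S : Matrix (Fin m) (Fin m) ℝ) : Matrix (Fin m) (Fin m) ℝ :=
  cfc (fun t : ℝ => max t 1) S

theorem supOne_eq {m : ℕ} {S : Matrix (Fin m) (Fin m) ℝ} (hS : S.IsHermitian) :
    supOne S = (hS.eigenvectorUnitary : Matrix (Fin m) (Fin m) ℝ) *
      Matrix.diagonal (fun i => max (hS.eigenvalues i) 1) *
      (hS.eigenvectorUnitary : Matrix (Fin m) (Fin m) ℝ).transpose := by
  rw [supOne, hS.cfc_eq, Matrix.IsHermitian.cfc, Unitary.conjStarAlgAut_apply,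
    Matrix.star_eq_conjTranspose, Matrix.conjTranspose_eq_transpose_of_trivial]
  rfl

/-! ### Statistical experiments and deficiency -/

/-- A statistical experiment with parameter set `Θ` and sample space `𝓧`. -/
structure Experiment (Θ 𝓧 : Type*) [MeasurableSpace 𝓧] where
  law : Θ → Measure 𝓧
  isProbabilityMeasure : ∀ θ, IsProbabilityMeasure (law θ)

/-- The risk of the (randomized) decision rule `ρ` at the parameter `θ` for the loss `L`. -/
noncomputable def risk {Θ 𝓧 D : Type*} [MeasurableSpace 𝓧] [MeasurableSpace D]
    (E : Experiment Θ 𝓧) (L : Θ → D → ℝ) (ρ : Kernel 𝓧 D) (θ : Θ) : ℝ :=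
  ∫ x, ∫ y, L θ y ∂(ρ x) ∂(E.law θ)

/-- `E` is `ε`-deficient with respect to `F`: for every set `Θ₀` of parameters, every decision
space `D`, every loss function `L`, bounded and measurable in the decision, and every (randomized)
decision rule `ρ` of `F` there is a decision rule `τ` of `E` whose risk exceeds that of `ρ` by at
most `ε θ * sup_y |L θ y|`, for all `θ` in `Θ₀`. -/
def IsDeficient {Θ 𝓧 𝓨 : Type*} [MeasurableSpace 𝓧] [MeasurableSpace 𝓨]
    (ε : Θ → ℝ) (E : Experiment Θ 𝓧) (F : Experiment Θ 𝓨) : Prop :=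
  ∀ (Θ₀ : Set Θ) (D : Type) [MeasurableSpace D] (L : Θ → D → ℝ),
    (∀ θ, Measurable (L θ)) → (∀ θ, BddAbove (Set.range fun y => |L θ y|)) →
    ∀ ρ : Kernel 𝓨 D, IsMarkovKernel ρ →
      ∃ τ : Kernel 𝓧 D, IsMarkovKernel τ ∧
        ∀ θ ∈ Θ₀, risk E L τ θ ≤ risk F L ρ θ + ε θ * ⨆ y, |L θ y|

/-- The deficiency `δ(E, F)`: the infimum of the constants `ε ≥ 0` such that `E` is
`ε`-deficient with respect to `F`. -/
noncomputable def deficiency {Θ 𝓧 𝓨 : Type*} [MeasurableSpace 𝓧] [MeasurableSpace 𝓨]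
    (E : Experiment Θ 𝓧) (F : Experiment Θ 𝓨) : ℝ :=
  sInf {ε : ℝ | 0 ≤ ε ∧ IsDeficient (fun _ => ε) E F}

/-- The total variation norm `‖P - Q‖`, which is `∫ |p - q|` when `P` and `Q` have densities
`p` and `q`; it lies between `0` and `2` for probability measures. -/
noncomputable def tvNorm {𝓧 : Type*} [MeasurableSpace 𝓧] (P Q : Measure 𝓧)
    [IsFiniteMeasure P] [IsFiniteMeasure Q] : ℝ :=
  (P.toSignedMeasure - Q.toSignedMeasure).totalVariation.real Set.univ

/-! ### Linear normal experiments and block codes -/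

/-- The linear normal experiment with law `N(A'β, S)` at the parameter `β ∈ ℝ^M`. -/
noncomputable def linearNormalExperiment {M n : ℕ} (A : Matrix (Fin M) (Fin n) ℝ)
    (S : Matrix (Fin n) (Fin n) ℝ) : Experiment (Fin M → ℝ) (EuclideanSpace ℝ (Fin n)) where
  law β := multivariateGaussian (WithLp.toLp 2 (A.transpose.mulVec β)) S
  isProbabilityMeasure _ := inferInstance

/-- The experiment of the block code whose codewords are the rows of the code matrix `A`, used
over the additive white Gaussian noise channel with noise covariance `σ² I`. -/
noncomputable def codeExperiment {M n : ℕ} (A : Matrix (Fin M) (Fin n) ℝ) (σ : ℝ) :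
    Experiment (Fin M → ℝ) (EuclideanSpace ℝ (Fin n)) :=
  linearNormalExperiment A (σ ^ 2 • (1 : Matrix (Fin n) (Fin n) ℝ))

/-- The probability that the decoder `d` of the code `A` does not return the message `i` when `i`
is transmitted, that is at the parameter `e_i`. -/
noncomputable def packetErrorProb {M n : ℕ} (A : Matrix (Fin M) (Fin n) ℝ) (σ : ℝ)
    (d : EuclideanSpace ℝ (Fin n) → Fin M) (i : Fin M) : ℝ :=
  ((codeExperiment A σ).law (Pi.single i 1)).real {z | d z ≠ i}

end CodeComparison

/-! Put `C = ((AA')⁺B)'A`. The range condition gives `CA' = B'` and `CC' = S := B'(AA')⁺B`, so `Cz`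
has the mean of the second code and covariance `σ²S`. Adding independent Gaussian noise raises the
covariance to `σ²(S ∨ I)`. Any rule of the second code applied to this vector has risk within `sup
|L|` times `‖N(0, S ∨ I) - N(0, I)‖` of its own risk. This is the upper bound for the deficiency
(`isDeficient_tvNorm`).

For the lower bound (`tvNorm_le_of_isDeficient`), let `G` be the ellipsoid where the density of
`N(0, S ∨ I)` is at most that of `N(0, I)`; the total variation norm is twice the difference of the
masses of `G`. Consider the loss `±1` according to whether `B'β + σG` misses or covers the decision.
The identity rule of the second code covers with probability `N(0, I)(G)`. For the first code take
Gaussian priors of growing variance: given the observation, the standardized target is normal with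
covariance `cS`, `c < 1`. By Anderson's inequality (`piGaussian_shift_le`) no rule covers with
average probability above `N(0, cS)(G)`, and `c → 1` gives `N(0, S)(G)`. Finally `N(0, S)(G) = N(0,
S ∨ I)(G)`, because `G` is unrestricted along eigenvectors of `S` with eigenvalue at most `1`. Hence
the bounds agree and the infimum is attained.

For decoders the loss is the error indicator. Deficiency only yields a randomized decoder; since `n
≥ 1`, the laws are atomless and finitely many error probabilities can be matched exactly by a
deterministic decoder (`exists_measurable_decision`), through an extreme point argument. In (a),
positivity of `AA' - BB'` implies the range condition and `S ≤ I`, so the deficiency is `0`. -/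

namespace CodeComparison

/-! ### Elimination of randomization by extreme points -/

section Derandomization

open Set Filter Topology

/-- Local convexity of finite products of weak duals is what the Krein–Milman theorem needs below.
-/
instance locallyConvexSpace_pi {ι : Type*} (E : ι → Type*) [∀ i, AddCommGroup (E i)]
    [∀ i, Module ℝ (E i)] [∀ i, TopologicalSpace (E i)] [∀ i, LocallyConvexSpace ℝ (E i)] :
    LocallyConvexSpace ℝ (∀ i, E i) :=
  LocallyConvexSpace.iInf fun i => LocallyConvexSpace.induced (LinearMap.proj (R := ℝ) (φ := E) i)

instance locallyConvexSpace_weakDual {V : Type*} [NormedAddCommGroup V] [NormedSpace ℝ V] :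
    LocallyConvexSpace ℝ (WeakDual ℝ V) :=
  inferInstanceAs (LocallyConvexSpace ℝ (WeakBilin _))

/-- A set of positive measure for an atomless measure meets three disjoint measurable sets in
positive measure. -/
theorem exists_three_disjoint {X : Type*} [TopologicalSpace X] [SecondCountableTopology X]
    [T2Space X] [MeasurableSpace X] [BorelSpace X] (ν : Measure X) [NullSingletonClass ν]
    {E : Set X} (hE : ν E ≠ 0) :
    ∃ F : Fin 3 → Set X, (∀ k, MeasurableSet (F k)) ∧ Pairwise (fun k l => Disjoint (F k) (F l)) ∧
      ∀ k, ν (E ∩ F k) ≠ 0 := by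
  -- Removing a finite set costs no mass, so `E` has infinitely many points all of whose
  -- neighbourhoods meet `E` in positive measure; three of them are then separated.
  have key : ∀ s : Set X, s.Finite → ∃ x ∈ E \ s, ∀ t ∈ 𝓝[E] x, 0 < ν t := by
    intro s hs
    have h : ν (E \ s) ≠ 0 := by
      rwa [measure_sdiff_null (hs.measure_zero ν)]
    obtain ⟨x, hx, hpos⟩ := exists_mem_forall_mem_nhdsWithin_pos_measure h
    exact ⟨x, hx, fun t ht => hpos t (nhdsWithin_mono x sdiff_subset ht)⟩
  obtain ⟨x, -, hxp⟩ := key ∅ finite_empty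
  obtain ⟨y, hy, hyp⟩ := key {x} (finite_singleton x)
  obtain ⟨z, hz, hzp⟩ := key {x, y} ((finite_singleton y).insert x)
  have hyx : y ≠ x := by simpa using hy.2
  have hz' : z ≠ x ∧ z ≠ y := by simpa using hz.2
  obtain ⟨U, hU, hUd⟩ := ((((finite_singleton z).insert y).insert x)).t2_separation
  have hdis : ∀ a ∈ ({x, y, z} : Set X), ∀ b ∈ ({x, y, z} : Set X), a ≠ b →
      Disjoint (U a) (U b) := fun a ha b hb hab => hUd ha hb hab
  have hxy := hdis x (by simp) y (by simp) hyx.symm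
  have hxz := hdis x (by simp) z (by simp) hz'.1.symm
  have hyz := hdis y (by simp) z (by simp) hz'.2.symm
  have hpos : ∀ a, (∀ t ∈ 𝓝[E] a, 0 < ν t) → ν (E ∩ U a) ≠ 0 := fun a ha =>
    (ha _ (inter_mem self_mem_nhdsWithin (mem_nhdsWithin_of_mem_nhds
      ((hU a).2.mem_nhds (hU a).1)))).ne'
  refine ⟨![U x, U y, U z], ?_, ?_, ?_⟩
  · intro k; fin_cases k <;> exact (hU _).2.measurableSet
  · intro k l hkl
    fin_cases k <;> fin_cases l <;> first | exact absurd rfl hkl | skip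
    · exact hxy
    · exact hxz
    · exact hxy.symm
    · exact hyz
    · exact hxz.symm
    · exact hyz.symm
  · intro k; fin_cases k
    · exact hpos x hxp
    · exact hpos y hyp
    · exact hpos z hzp

/-- Two linear equations in three unknowns have a small nonzero solution. -/
theorem exists_small_solution (u v : Fin 3 → ℝ) {δ : ℝ} (hδ : 0 < δ) :
    ∃ a : Fin 3 → ℝ, a ≠ 0 ∧ (∀ k, |a k| ≤ δ) ∧ ∑ k, a k * u k = 0 ∧ ∑ k, a k * v k = 0 := by
  let f : (Fin 3 → ℝ) →ₗ[ℝ] (Fin 2 → ℝ) := Matrix.mulVecLin (Matrix.of ![u, v])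
  have hf : LinearMap.ker f ≠ ⊥ := LinearMap.ker_ne_bot_of_finrank_lt (by simp)
  obtain ⟨a, ha, ha0⟩ := (Submodule.ne_bot_iff _).1 hf
  have hau : ∑ k, a k * u k = 0 := by
    have := congrFun (LinearMap.mem_ker.1 ha) 0
    simpa [f, Matrix.mulVec, dotProduct, mul_comm] using this
  have hav : ∑ k, a k * v k = 0 := by
    have := congrFun (LinearMap.mem_ker.1 ha) 1
    simpa [f, Matrix.mulVec, dotProduct, mul_comm] using this
  have hpos : 0 < ‖a‖ := norm_pos_iff.2 ha0
  refine ⟨(δ / ‖a‖) • a, smul_ne_zero (div_pos hδ hpos).ne' ha0, fun k => ?_, ?_, ?_⟩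
  · have hk : |a k| ≤ ‖a‖ := norm_le_pi_norm a k
    rw [Pi.smul_apply, smul_eq_mul, abs_mul, abs_of_pos (div_pos hδ hpos), div_mul_eq_mul_div,
      div_le_iff₀ hpos]
    gcongr
  · simp only [Pi.smul_apply, smul_eq_mul, mul_assoc, ← Finset.mul_sum, hau, mul_zero]
  · simp only [Pi.smul_apply, smul_eq_mul, mul_assoc, ← Finset.mul_sum, hav, mul_zero]

section

variable {X : Type*} [MeasurableSpace X] (ν : Measure X) [IsFiniteMeasure ν]

/-- The constant function `1` as an element of `L²`. -/
noncomputable def oneL2 : Lp ℝ 2 ν := indicatorConstLp 2 MeasurableSet.univ (measure_ne_top ν _) 1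

theorem coeFn_oneL2 : oneL2 ν =ᵐ[ν] fun _ => (1 : ℝ) := by
  filter_upwards [indicatorConstLp_coeFn (p := 2) (hs := MeasurableSet.univ)
    (hμs := measure_ne_top ν _) (c := (1 : ℝ))] with x hx
  rw [oneL2, hx]; simp

omit [IsFiniteMeasure ν] in
variable {ν} in
theorem real_inner_eq_integral (f g : Lp ℝ 2 ν) : inner ℝ f g = ∫ x, f x * g x ∂ν := by
  rw [L2.inner_def]
  congr 1 with x
  simp [mul_comm]

omit [IsFiniteMeasure ν] in
variable {ν} in
theorem inner_nonneg_of_nonneg {f g : Lp ℝ 2 ν} (hf : 0 ≤ f) (hg : 0 ≤ g) :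
    0 ≤ inner ℝ f g := by
  rw [real_inner_eq_integral]
  refine integral_nonneg_of_ae ?_
  filter_upwards [(Lp.coeFn_nonneg f).2 hf, (Lp.coeFn_nonneg g).2 hg] with x h1 h2
  exact mul_nonneg h1 h2

variable {ν} in
theorem nonneg_of_inner_nonneg {f : Lp ℝ 2 ν} (hf : ∀ g : Lp ℝ 2 ν, 0 ≤ g → 0 ≤ inner ℝ f g) :
    0 ≤ f := by
  rw [← Lp.coeFn_nonneg]
  refine ae_nonneg_of_forall_setIntegral_nonneg ((Lp.memLp f).integrable (by norm_num)) ?_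
  intro s hs _
  rw [← L2.inner_indicatorConstLp_one (𝕜 := ℝ) hs (measure_ne_top ν s), real_inner_comm]
  refine hf _ ((Lp.coeFn_nonneg _).1 ?_)
  filter_upwards [indicatorConstLp_coeFn (p := 2) (hs := hs)
    (hμs := measure_ne_top ν s) (c := (1 : ℝ))] with x hx
  rw [hx]
  exact indicator_nonneg (fun _ _ => zero_le_one) x

variable {M : ℕ}

/-- The families of positive functionals on `L²`, of total mass the integral, with prescribed
values at given functions. -/
def weightFunctionals (h : Fin M → Lp ℝ 2 ν) (c : Fin M → ℝ) :
    Set (Fin M → WeakDual ℝ (Lp ℝ 2 ν)) :=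
  {f | (∀ i g, 0 ≤ g → 0 ≤ f i g) ∧ (∀ g, ∑ i, f i g = inner ℝ (oneL2 ν) g) ∧
    ∀ i, f i (h i) = c i}

variable {ν} in
-- Banach–Alaoglu: the conditions are weak-* closed, and positivity with prescribed total gives `f i
-- g ≤ f i |g| ≤ ⟨1, |g|⟩ ≤ ‖1‖ ‖g‖`.
theorem isCompact_weightFunctionals (h : Fin M → Lp ℝ 2 ν) (c : Fin M → ℝ) :
    IsCompact (weightFunctionals ν h c) := by
  have hev : ∀ i g, Continuous fun f : Fin M → WeakDual ℝ (Lp ℝ 2 ν) => f i g := fun i g =>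
    (WeakDual.eval_continuous g).comp (continuous_apply i)
  have hclosed : IsClosed (weightFunctionals ν h c) := by
    refine IsClosed.and ?_ (IsClosed.and ?_ ?_)
    · simp only [ofPred_forall]
      exact isClosed_iInter fun i => isClosed_iInter fun g => isClosed_iInter fun _ =>
        isClosed_le continuous_const (hev i g)
    · simp only [ofPred_forall]
      exact isClosed_iInter fun g =>
        isClosed_eq (continuous_finsetSum _ fun i _ => hev i g) continuous_const
    · simp only [ofPred_forall]
      exact isClosed_iInter fun i => isClosed_eq (hev i _) continuous_const
  refine (isCompact_univ_pi fun _ : Fin M =>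
    WeakDual.isCompact_closedBall (𝕜 := ℝ) (0 : StrongDual ℝ (Lp ℝ 2 ν)) ‖oneL2 ν‖).of_isClosed_subset
    hclosed ?_
  rintro f ⟨hf0, hf1, -⟩ i -
  rw [mem_preimage, mem_closedBall_zero_iff]
  have hle : ∀ g, f i g ≤ ‖oneL2 ν‖ * ‖g‖ := fun g => calc
    f i g ≤ f i |g| := by
        have := hf0 i (|g| - g) (sub_nonneg.2 (le_abs_self g))
        rw [map_sub] at this
        linarith
    _ ≤ ∑ j, f j |g| :=
        Finset.single_le_sum (f := fun j => f j |g|) (fun j _ => hf0 j _ (abs_nonneg g))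
          (Finset.mem_univ i)
    _ ≤ ‖oneL2 ν‖ * ‖g‖ := by
        rw [hf1, ← norm_abs_eq_norm g]
        exact real_inner_le_norm _ _
  refine ContinuousLinearMap.opNorm_le_bound _ (norm_nonneg _) fun g => ?_
  rw [WeakDual.toStrongDual_apply, Real.norm_eq_abs, abs_le]
  refine ⟨?_, hle g⟩
  have := hle (-g)
  rw [map_neg, norm_neg] at this
  linarith

/-- The Riesz representative of a functional on `L²`. -/
noncomputable def rieszRep {X : Type*} [MeasurableSpace X] {ν : Measure X}
    (f : WeakDual ℝ (Lp ℝ 2 ν)) : Lp ℝ 2 ν :=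
  (InnerProductSpace.toDual ℝ (Lp ℝ 2 ν)).symm (WeakDual.toStrongDual f)

theorem inner_rieszRep {X : Type*} [MeasurableSpace X] {ν : Measure X}
    (f : WeakDual ℝ (Lp ℝ 2 ν)) (g : Lp ℝ 2 ν) : inner ℝ (rieszRep f) g = f g := by
  rw [rieszRep, InnerProductSpace.toDual_symm_apply, WeakDual.toStrongDual_apply]

/-- The functional represented by an element of `L²`. -/
noncomputable def innerFunctional {X : Type*} [MeasurableSpace X] {ν : Measure X}
    (g : Lp ℝ 2 ν) : WeakDual ℝ (Lp ℝ 2 ν) :=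
  WeakDual.toStrongDual.symm (InnerProductSpace.toDual ℝ (Lp ℝ 2 ν) g)

theorem innerFunctional_apply {X : Type*} [MeasurableSpace X] {ν : Measure X}
    (g u : Lp ℝ 2 ν) : innerFunctional g u = inner ℝ g u := rfl

variable {ν} in
/-- Moving mass `g` from the weight `j` to the weight `i`. -/
theorem transfer_mem_weightFunctionals {h : Fin M → Lp ℝ 2 ν} {c : Fin M → ℝ}
    {f : Fin M → WeakDual ℝ (Lp ℝ 2 ν)} (hf : f ∈ weightFunctionals ν h c) {i j : Fin M}
    (hij : i ≠ j) {g : Lp ℝ 2 ν} (hi : 0 ≤ rieszRep (f i) + g) (hj : 0 ≤ rieszRep (f j) - g)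
    (hgi : inner ℝ g (h i) = 0) (hgj : inner ℝ g (h j) = 0) :
    f + (Pi.single i (innerFunctional g) - Pi.single j (innerFunctional g)) ∈
      weightFunctionals ν h c := by
  obtain ⟨h0, h1, h2⟩ := hf
  have e : ∀ k u, (f + (Pi.single i (innerFunctional g) - Pi.single j (innerFunctional g)) :
      Fin M → WeakDual ℝ (Lp ℝ 2 ν)) k u =
      f k u + ((if k = i then inner ℝ g u else 0) - (if k = j then inner ℝ g u else 0)) := by
    intro k u
    have hs : ∀ l, (Pi.single (M := fun _ => WeakDual ℝ (Lp ℝ 2 ν)) l (innerFunctional g) k) u =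
        if k = l then inner ℝ g u else 0 := by
      intro l
      by_cases hkl : k = l
      · subst hkl; simp [innerFunctional_apply]
      · rw [Pi.single_eq_of_ne hkl, if_neg hkl]; rfl
    rw [← hs i, ← hs j]
    rfl
  refine ⟨fun k u hu => ?_, fun u => ?_, fun k => ?_⟩
  · rw [e]
    by_cases hki : k = i
    · subst hki
      have := inner_nonneg_of_nonneg hi hu
      rw [inner_add_left, inner_rieszRep] at this
      simpa [hij] using this
    · by_cases hkj : k = j
      · subst hkj
        have := inner_nonneg_of_nonneg hj hu
        rw [inner_sub_left, inner_rieszRep] at this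
        simpa [hki, sub_eq_add_neg] using this
      · simpa [hki, hkj] using h0 k u hu
  · simp only [e, Finset.sum_add_distrib, Finset.sum_sub_distrib, h1]
    simp
  · rw [e, h2]
    by_cases hki : k = i
    · subst hki; simp [hij, hgi]
    · by_cases hkj : k = j
      · subst hkj; simp [hki, hgj]
      · simp [hki, hkj]

variable {ν} in
theorem rieszRep_nonneg {h : Fin M → Lp ℝ 2 ν} {c : Fin M → ℝ}
    {f : Fin M → WeakDual ℝ (Lp ℝ 2 ν)} (hf : f ∈ weightFunctionals ν h c) (i : Fin M) :
    0 ≤ rieszRep (f i) :=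
  nonneg_of_inner_nonneg fun g hg => by rw [inner_rieszRep]; exact hf.1 i g hg

variable {ν} in
theorem sum_rieszRep {h : Fin M → Lp ℝ 2 ν} {c : Fin M → ℝ}
    {f : Fin M → WeakDual ℝ (Lp ℝ 2 ν)} (hf : f ∈ weightFunctionals ν h c) :
    ∑ i, rieszRep (f i) = oneL2 ν := by
  refine ext_inner_right ℝ fun g => ?_
  rw [sum_inner, ← hf.2.1 g]
  exact Finset.sum_congr rfl fun i _ => inner_rieszRep _ _

variable {ν} in
/-- At an extreme point, two weights are never positive simultaneously. -/
theorem rieszRep_mul_eq_zero_of_mem_extremePoints [TopologicalSpace X]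
    [SecondCountableTopology X] [T2Space X] [BorelSpace X] [NullSingletonClass ν]
    {h : Fin M → Lp ℝ 2 ν} {c : Fin M → ℝ} {f : Fin M → WeakDual ℝ (Lp ℝ 2 ν)}
    (hf : f ∈ (weightFunctionals ν h c).extremePoints ℝ) {i j : Fin M} (hij : i ≠ j) :
    ∀ᵐ x ∂ν, ¬ (0 < rieszRep (f i) x ∧ 0 < rieszRep (f j) x) := by
  obtain ⟨hfK, hext⟩ := mem_extremePoints.1 hf
  set p := rieszRep (f i) with hp
  set q := rieszRep (f j) with hq
  have hpm : Measurable p := (Lp.stronglyMeasurable p).measurable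
  have hqm : Measurable q := (Lp.stronglyMeasurable q).measurable
  -- On `E n` both weights leave room for a perturbation of size `1 / (n + 1)` in either direction.
  let E : ℕ → Set X := fun n => {x | (1 : ℝ) / (n + 1) ≤ p x ∧ (1 : ℝ) / (n + 1) ≤ q x}
  have hEm : ∀ n, MeasurableSet (E n) := fun n =>
    (measurableSet_le measurable_const hpm).inter (measurableSet_le measurable_const hqm)
  suffices hE0 : ∀ n, ν (E n) = 0 by
    refine measure_mono_null ?_ (measure_iUnion_null hE0)
    intro x hx
    obtain ⟨hx1, hx2⟩ : 0 < p x ∧ 0 < q x := by simpa using hx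
    obtain ⟨n, hn⟩ := exists_nat_one_div_lt (lt_min hx1 hx2)
    exact mem_iUnion.2 ⟨n, (lt_min_iff.1 hn).1.le, (lt_min_iff.1 hn).2.le⟩
  intro n
  by_contra hne
  have hδ : (0 : ℝ) < 1 / (n + 1) := by positivity
  obtain ⟨F, hFm, hFd, hF⟩ := exists_three_disjoint ν hne
  have hGm : ∀ k, MeasurableSet (E n ∩ F k) := fun k => (hEm n).inter (hFm k)
  let w : Fin 3 → Lp ℝ 2 ν := fun k => indicatorConstLp 2 (hGm k) (measure_ne_top ν _) 1
  -- Only the weights `i` and `j` move, so two integrals must be preserved; three pieces leave a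
  -- nonzero direction.
  obtain ⟨a, ha0, had, hai, haj⟩ := exists_small_solution (fun k => inner ℝ (w k) (h i))
    (fun k => inner ℝ (w k) (h j)) hδ
  let g : Lp ℝ 2 ν := ∑ k, a k • w k
  have hgi : inner ℝ g (h i) = 0 := by
    simp only [g, sum_inner, real_inner_smul_left]; exact hai
  have hgj : inner ℝ g (h j) = 0 := by
    simp only [g, sum_inner, real_inner_smul_left]; exact haj
  have hgx : ∀ᵐ x ∂ν, g x = ∑ k, a k * (E n ∩ F k).indicator (fun _ => (1 : ℝ)) x := by
    have h1 : ∀ᵐ x ∂ν, ∀ k, w k x = (E n ∩ F k).indicator (fun _ => (1 : ℝ)) x :=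
      ae_all_iff.2 fun k => indicatorConstLp_coeFn
    have h2 : ∀ᵐ x ∂ν, ∀ k, (a k • w k : Lp ℝ 2 ν) x = a k * w k x :=
      ae_all_iff.2 fun k => Lp.coeFn_smul _ _
    filter_upwards [h1, h2, Lp.coeFn_finsetSum Finset.univ fun k => a k • w k] with x h1 h2 h3
    simp only [g, h3, Finset.sum_apply, h2, h1]
  have hgval : ∀ k x, x ∈ E n ∩ F k →
      ∑ k, a k * (E n ∩ F k).indicator (fun _ => (1 : ℝ)) x = a k := by
    intro k x hx
    rw [Finset.sum_eq_single k]
    · rw [indicator_of_mem hx, mul_one]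
    · intro l _ hl
      rw [indicator_of_notMem, mul_zero]
      exact fun h => (disjoint_left.1 (hFd hl) h.2 hx.2)
    · simp
  have hbound : ∀ᵐ x ∂ν, |g x| ≤ p x ∧ |g x| ≤ q x := by
    filter_upwards [hgx, (Lp.coeFn_nonneg p).2 (rieszRep_nonneg hfK i),
      (Lp.coeFn_nonneg q).2 (rieszRep_nonneg hfK j)] with x hx hp0 hq0
    rw [hx]
    by_cases hk : ∃ k, x ∈ E n ∩ F k
    · obtain ⟨k, hk⟩ := hk
      rw [hgval k x hk]
      exact ⟨(had k).trans hk.1.1, (had k).trans hk.1.2⟩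
    · push Not at hk
      have : ∑ k, a k * (E n ∩ F k).indicator (fun _ => (1 : ℝ)) x = 0 :=
        Finset.sum_eq_zero fun k _ => by rw [indicator_of_notMem (hk k), mul_zero]
      rw [this, abs_zero]
      exact ⟨hp0, hq0⟩
  have hpg : 0 ≤ p + g ∧ 0 ≤ p - g ∧ 0 ≤ q + g ∧ 0 ≤ q - g := by
    simp only [← Lp.coeFn_nonneg]
    refine ⟨?_, ?_, ?_, ?_⟩
    · filter_upwards [hbound, Lp.coeFn_add p g] with x hx he
      rw [he]; exact neg_le_iff_add_nonneg'.1 (neg_le.1 ((neg_le_abs _).trans hx.1))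
    · filter_upwards [hbound, Lp.coeFn_sub p g] with x hx he
      rw [he]; exact sub_nonneg.2 ((le_abs_self _).trans hx.1)
    · filter_upwards [hbound, Lp.coeFn_add q g] with x hx he
      rw [he]; exact neg_le_iff_add_nonneg'.1 (neg_le.1 ((neg_le_abs _).trans hx.2))
    · filter_upwards [hbound, Lp.coeFn_sub q g] with x hx he
      rw [he]; exact sub_nonneg.2 ((le_abs_self _).trans hx.2)
  have hK1 := transfer_mem_weightFunctionals hfK hij hpg.1 hpg.2.2.2 hgi hgj
  -- Exchanging `i` and `j` moves `g` the other way, so `f` is the midpoint of the two perturbed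
  -- families and extremality forces `g = 0`.
  have hK2 := transfer_mem_weightFunctionals hfK hij.symm hpg.2.2.1 hpg.2.1 hgj hgi
  have hmid := (hext _ hK1 _ hK2 ⟨1 / 2, 1 / 2, by norm_num, by norm_num, by norm_num, by
    rw [← smul_add, ← smul_right_injective _ (two_ne_zero (α := ℝ)) |>.eq_iff, smul_smul]
    norm_num
    rw [two_smul]
    abel⟩).1
  have hg0 : g = 0 := by
    refine ext_inner_right ℝ fun u => ?_
    have := congrArg (fun f' : Fin M → WeakDual ℝ (Lp ℝ 2 ν) => f' i u) (add_eq_left.1 hmid)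
    simp only [Pi.sub_apply, Pi.single_eq_same, Pi.single_eq_of_ne hij, sub_zero] at this
    rw [inner_zero_left]
    exact this
  obtain ⟨k, hk⟩ : ∃ k, a k ≠ 0 := Function.ne_iff.1 ha0
  refine hF k ?_
  have hz : ∀ᵐ x ∂ν, g x = 0 := by rw [hg0]; exact Lp.coeFn_zero _ _ _
  refine measure_mono_null (fun x hx => ?_) (ae_iff.1 (hgx.and hz))
  rintro ⟨h1, h2⟩
  rw [h2, hgval k x hx] at h1
  exact hk h1.symm

end

/-- Elimination of randomization for finitely many atomless measures and finitely many decisions. -/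
theorem exists_measurable_decision {X : Type*} [MeasurableSpace X] [TopologicalSpace X]
    [SecondCountableTopology X] [T2Space X] [BorelSpace X] {M : ℕ} [Nonempty (Fin M)]
    (μ : Fin M → Measure X) [∀ i, IsFiniteMeasure (μ i)] [∀ i, NullSingletonClass (μ i)]
    (τ : Kernel X (Fin M)) [IsMarkovKernel τ] :
    ∃ d : X → Fin M, Measurable d ∧ ∀ i, (μ i).real (d ⁻¹' {i}) = ∫ x, (τ x).real {i} ∂μ i := by
  obtain ⟨ν, hν⟩ : ∃ ν, ν = ∑ i, μ i := ⟨_, rfl⟩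
  have hle : ∀ i, μ i ≤ ν := fun i => by
    rw [hν]; exact Finset.single_le_sum (f := μ) (fun _ _ => Measure.zero_le _) (Finset.mem_univ i)
  have hac : ∀ i, μ i ≪ ν := fun i => (hle i).absolutelyContinuous
  have : IsFiniteMeasure ν := by rw [hν]; infer_instance
  have : NullSingletonClass ν := ⟨fun x => by rw [hν]; simp⟩
  -- Since `μ i ≤ ν`, the densities are bounded by `1` and hence lie in `L²`.
  have hhm : ∀ i, MemLp (fun x => ((μ i).rnDeriv ν x).toReal) 2 ν := fun i => by
    refine MemLp.of_bound (Measure.measurable_rnDeriv _ _).ennreal_toReal.aestronglyMeasurable 1 ?_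
    filter_upwards [Measure.rnDeriv_le_one_of_le (hle i)] with x hx
    rw [Real.norm_eq_abs, abs_of_nonneg ENNReal.toReal_nonneg]
    exact ENNReal.toReal_mono ENNReal.one_ne_top hx
  have hφm : ∀ i, MemLp (fun x => (τ x).real {i}) 2 ν := fun i =>
    MemLp.of_bound
      ((τ.measurable_coe (measurableSet_singleton i)).ennreal_toReal.aestronglyMeasurable) 1
      (ae_of_all _ fun x => by
        rw [Real.norm_eq_abs, abs_of_nonneg measureReal_nonneg]; exact measureReal_le_one)
  let h : Fin M → Lp ℝ 2 ν := fun i => (hhm i).toLp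
  let φ : Fin M → Lp ℝ 2 ν := fun i => (hφm i).toLp
  have hinner : ∀ (g : Lp ℝ 2 ν) (i), inner ℝ g (h i) = ∫ x, g x ∂μ i := fun g i => by
    rw [real_inner_eq_integral, ← integral_rnDeriv_smul (hac i)]
    refine integral_congr_ae ?_
    filter_upwards [(hhm i).coeFn_toLp] with x hx
    rw [hx, smul_eq_mul, mul_comm]
  -- The randomized rule itself shows that the compact set is nonempty.
  have hφK : (fun i => innerFunctional (φ i)) ∈
      weightFunctionals ν h fun i => ∫ x, (τ x).real {i} ∂μ i := by
    refine ⟨fun i g hg => inner_nonneg_of_nonneg ((Lp.coeFn_nonneg _).1 ?_) hg, fun g => ?_,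
      fun i => ?_⟩
    · filter_upwards [(hφm i).coeFn_toLp] with x hx
      rw [hx]; exact measureReal_nonneg
    · simp only [innerFunctional_apply, ← sum_inner]
      congr 1
      refine Lp.ext ?_
      have h1 : ∀ᵐ x ∂ν, ∀ i, φ i x = (τ x).real {i} :=
        ae_all_iff.2 fun i => (hφm i).coeFn_toLp
      filter_upwards [h1, Lp.coeFn_finsetSum Finset.univ φ, coeFn_oneL2 ν] with x h1 h2 h3
      rw [h2, h3, Finset.sum_apply]
      simp only [h1]
      rw [← measureReal_biUnion_finset (by simp [PairwiseDisjoint, Set.Pairwise])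
        (fun i _ => measurableSet_singleton i),
        show (⋃ b ∈ Finset.univ, {b} : Set (Fin M)) = univ by ext; simp]
      exact probReal_univ
    · rw [innerFunctional_apply, hinner]
      exact integral_congr_ae ((hac i).ae_le (hφm i).coeFn_toLp)
  obtain ⟨f, hf⟩ := (isCompact_weightFunctionals h _).extremePoints_nonempty ⟨_, hφK⟩
  have hfK := hf.1
  let p : Fin M → X → ℝ := fun i => rieszRep (f i)
  have hpm : ∀ i, Measurable (p i) := fun i => (Lp.stronglyMeasurable _).measurable
  -- Selects an index of positive weight; at an extreme point it is almost everywhere unique, and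
  -- its weight is `1`.
  let e : (Fin M → Prop) → Fin M := fun P => Classical.epsilon P
  let d : X → Fin M := fun x => e fun i => 0 < p i x
  have hd : Measurable d := (Measurable.of_discrete (f := e)).comp
    (measurable_pi_lambda _ fun i => measurableSet_setOfPred.1
      (measurableSet_lt measurable_const (hpm i)))
  refine ⟨d, hd, fun i => ?_⟩
  have hall : ∀ᵐ x ∂ν, ∀ i j, i ≠ j → ¬ (0 < p i x ∧ 0 < p j x) := by
    refine ae_all_iff.2 fun i => ae_all_iff.2 fun j => ?_
    by_cases hij : i = j
    · exact ae_of_all _ fun x hx => absurd hij hx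
    · filter_upwards [rieszRep_mul_eq_zero_of_mem_extremePoints hf hij] with x hx _ using hx
  have hnn : ∀ᵐ x ∂ν, ∀ i, 0 ≤ p i x :=
    ae_all_iff.2 fun i => (Lp.coeFn_nonneg _).2 (rieszRep_nonneg hfK i)
  have hsum : ∀ᵐ x ∂ν, ∑ i, p i x = 1 := by
    have := sum_rieszRep hfK
    filter_upwards [Lp.coeFn_finsetSum Finset.univ fun i => rieszRep (f i), coeFn_oneL2 ν]
      with x h1 h2
    rw [this, h2, Finset.sum_apply] at h1
    exact h1.symm
  have hind : ∀ᵐ x ∂ν, p i x = (d ⁻¹' {i}).indicator (fun _ => (1 : ℝ)) x := by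
    filter_upwards [hall, hnn, hsum] with x h1 h2 h3
    have hex : ∃ k, 0 < p k x := by
      by_contra hno
      push Not at hno
      rw [Finset.sum_eq_zero fun k _ => le_antisymm (hno k) (h2 k)] at h3
      exact zero_ne_one h3
    have hdx : 0 < p (d x) x := Classical.epsilon_spec hex
    have hz : ∀ k, k ≠ d x → p k x = 0 := fun k hk =>
      le_antisymm (not_lt.1 fun hlt => h1 k (d x) hk ⟨hlt, hdx⟩) (h2 k)
    rw [Finset.sum_eq_single (d x) (fun k _ hk => hz k hk) (by simp)] at h3
    by_cases hi : d x = i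
    · rw [indicator_of_mem (by exact hi), ← hi, h3]
    · rw [indicator_of_notMem (by exact hi), hz i (Ne.symm hi)]
  have : f i (h i) = ∫ x, (τ x).real {i} ∂μ i := hfK.2.2 i
  rw [← inner_rieszRep, hinner] at this
  rw [← this, integral_congr_ae ((hac i).ae_le hind),
    ← integral_indicator_one (hd (measurableSet_singleton i))]
  rfl

end Derandomization

/-! ### Anderson's inequality for axis-parallel ellipsoids -/

section Anderson

open Set

theorem gaussianPDF_zero_one_antitone {x y : ℝ} (h : |x| ≤ |y|) :
    gaussianPDF 0 1 y ≤ gaussianPDF 0 1 x := by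
  simp only [gaussianPDF_def, gaussianPDFReal_def]
  refine ENNReal.ofReal_le_ofReal ?_
  have := sq_le_sq.2 h
  rw [sub_zero, sub_zero]
  gcongr _ * Real.exp (-?_ / _)

/-- Among the intervals of a given length, the centred one has the largest standard Gaussian
measure. -/
theorem gaussianReal_Icc_le (c : ℝ) {h : ℝ} (hh : 0 ≤ h) :
    gaussianReal 0 1 (Icc (c - h) (c + h)) ≤ gaussianReal 0 1 (Icc (-h) h) := by
  set I := Icc (c - h) (c + h)
  set J := Icc (-h) h
  have hI : MeasurableSet I := measurableSet_Icc
  have hJ : MeasurableSet J := measurableSet_Icc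
  -- The two differences have equal length; the density is at most its value at `h` on `I \ J` and
  -- at least that on `J \ I`.
  have hv : volume (I \ J) = volume (J \ I) := by
    have h1 : volume I = volume J := by
      simp only [I, J, Real.volume_Icc]; congr 1; ring
    have h2 := measure_sdiff_add_inter (μ := volume) I hJ
    have h3 := measure_sdiff_add_inter (μ := volume) J hI
    rw [h1, ← h3, inter_comm J I] at h2
    refine (ENNReal.add_left_inj ?_).1 h2
    exact measure_ne_top_of_subset inter_subset_left (by simp [I])
  have hle : gaussianReal 0 1 (I \ J) ≤ gaussianReal 0 1 (J \ I) := by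
    rw [gaussianReal_of_var_ne_zero 0 one_ne_zero, withDensity_apply _ (hI.diff hJ),
      withDensity_apply _ (hJ.diff hI)]
    calc ∫⁻ x in I \ J, gaussianPDF 0 1 x
        ≤ ∫⁻ _ in I \ J, gaussianPDF 0 1 h := by
          refine setLIntegral_mono measurable_const fun x hx => ?_
          refine gaussianPDF_zero_one_antitone ?_
          rw [abs_of_nonneg hh]
          by_contra hlt
          exact hx.2 (abs_le.1 (not_le.1 hlt).le)
      _ = ∫⁻ _ in J \ I, gaussianPDF 0 1 h := by simp only [setLIntegral_const, hv]
      _ ≤ ∫⁻ x in J \ I, gaussianPDF 0 1 x := by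
          refine setLIntegral_mono (measurable_gaussianPDF 0 1) fun x hx => ?_
          refine gaussianPDF_zero_one_antitone ?_
          rw [abs_of_nonneg hh]
          exact abs_le.2 hx.1
  rw [← measure_sdiff_add_inter I hJ, ← measure_sdiff_add_inter J hI, inter_comm J I]
  gcongr

theorem gaussianReal_sq_add_le (a b r : ℝ) :
    gaussianReal 0 1 {t | (a * t + b) ^ 2 ≤ r} ≤ gaussianReal 0 1 {t | (a * t) ^ 2 ≤ r} := by
  rcases lt_or_ge r 0 with hr | hr
  · have h0 : {t : ℝ | (a * t + b) ^ 2 ≤ r} = ∅ :=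
      eq_empty_of_forall_notMem fun t ht => absurd (sq_nonneg (a * t + b))
        (not_le.2 (((mem_ofPred_eq (p := fun t : ℝ => (a * t + b) ^ 2 ≤ r)).mp ht).trans_lt hr))
    rw [h0, measure_empty]
    exact zero_le
  rcases eq_or_ne a 0 with rfl | ha
  · refine measure_mono fun t _ => ?_
    simpa using hr
  have ha' : 0 < |a| := abs_pos.2 ha
  have key : ∀ c t : ℝ, (a * (t - c)) ^ 2 ≤ r ↔ |t - c| ≤ √r / |a| := by
    intro c t
    rw [le_div_iff₀ ha', ← abs_mul, mul_comm (t - c), ← Real.sqrt_sq_eq_abs,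
      Real.sqrt_le_sqrt_iff hr]
  convert gaussianReal_Icc_le (-b / a) (h := √r / |a|) (by positivity) using 2
  · ext t
    have e : a * t + b = a * (t - -b / a) := by field_simp; ring
    rw [mem_ofPred_eq, e, key, abs_le, mem_Icc]
    constructor <;> rintro ⟨h1, h2⟩ <;> constructor <;> linarith
  · ext t
    have := key 0 t
    rw [sub_zero] at this
    rw [mem_ofPred_eq, this, abs_le, mem_Icc]

variable {m : ℕ}

/-- The standard Gaussian measure on `ℝ^m` as a product measure. -/
noncomputable abbrev piGaussian (m : ℕ) : Measure (Fin m → ℝ) :=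
  Measure.pi fun _ => gaussianReal 0 1

theorem measurableSet_sum_sq_le (a b : Fin m → ℝ) (r : ℝ) :
    MeasurableSet {x : Fin m → ℝ | ∑ i, (a i * x i + b i) ^ 2 ≤ r} :=
  measurableSet_le (by fun_prop) measurable_const

/-- By Fubini, with all coordinates but `j` frozen, the section is a symmetric interval shifted in
one variable, and centring it does not decrease its mass. -/
theorem piGaussian_update_le (a b : Fin m → ℝ) (r : ℝ) (j : Fin m) :
    piGaussian m {x | ∑ i, (a i * x i + b i) ^ 2 ≤ r} ≤
      piGaussian m {x | ∑ i, (a i * x i + Function.update b j 0 i) ^ 2 ≤ r} := by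
  rw [← lintegral_indicator_one (measurableSet_sum_sq_le a b r),
    ← lintegral_indicator_one (measurableSet_sum_sq_le a _ r)]
  refine lintegral_le_of_lmarginal_le {j}
    (measurable_one.indicator (measurableSet_sum_sq_le a b r))
    (measurable_one.indicator (measurableSet_sum_sq_le a _ r)) ?_
  simp only [lmarginal_singleton]
  intro x
  have hsum : ∀ (b' : Fin m → ℝ) (t : ℝ), ∑ i, (a i * Function.update x j t i + b' i) ^ 2 =
      (a j * t + b' j) ^ 2 + ∑ i ∈ Finset.univ.erase j, (a i * x i + b' i) ^ 2 := by
    intro b' t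
    rw [← Finset.add_sum_erase _ _ (Finset.mem_univ j), Function.update_self]
    congr 1
    exact Finset.sum_congr rfl fun i hi => by
      rw [Function.update_of_ne (Finset.ne_of_mem_erase hi)]
  have hb : ∑ i ∈ Finset.univ.erase j, (a i * x i + Function.update b j 0 i) ^ 2 =
      ∑ i ∈ Finset.univ.erase j, (a i * x i + b i) ^ 2 :=
    Finset.sum_congr rfl fun i hi => by
      rw [Function.update_of_ne (Finset.ne_of_mem_erase hi)]
  have hlin : ∀ b' : Fin m → ℝ, ∫⁻ t, {x : Fin m → ℝ | ∑ i, (a i * x i + b' i) ^ 2 ≤ r}.indicator 1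
      (Function.update x j t) ∂gaussianReal 0 1 = gaussianReal 0 1 {t | (a j * t + b' j) ^ 2 ≤
        r - ∑ i ∈ Finset.univ.erase j, (a i * x i + b' i) ^ 2} := by
    intro b'
    rw [← lintegral_indicator_one (measurableSet_le (by fun_prop) measurable_const)]
    congr 1 with t
    simp only [indicator_apply, mem_ofPred_eq, hsum, le_sub_iff_add_le, Pi.one_apply]
  beta_reduce
  rw [hlin, hlin, hb, Function.update_self]
  simpa using gaussianReal_sq_add_le (a j) (b j) _

/-- Anderson's inequality for an ellipsoid with the same axes as the Gaussian measure. -/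
theorem piGaussian_shift_le (a b : Fin m → ℝ) (r : ℝ) :
    piGaussian m {x | ∑ i, (a i * x i + b i) ^ 2 ≤ r} ≤
      piGaussian m {x | ∑ i, (a i * x i) ^ 2 ≤ r} := by
  have key : ∀ s : Finset (Fin m), piGaussian m {x | ∑ i, (a i * x i + b i) ^ 2 ≤ r} ≤
      piGaussian m {x | ∑ i, (a i * x i + if i ∈ s then 0 else b i) ^ 2 ≤ r} := by
    intro s
    induction s using Finset.induction_on with
    | empty => simp
    | insert j s hj ih =>
      refine ih.trans ((piGaussian_update_le a _ r j).trans_eq ?_)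
      congr! 7 with x i
      by_cases hij : i = j
      · subst hij; simp
      · simp [hij]
  simpa using key Finset.univ

end Anderson

/-! ### Total variation norm: test functions and Hahn sets -/

section TotalVariation

variable {X : Type*} [MeasurableSpace X]

theorem integral_sub_integral_le_tvNorm (P Q : Measure X) [IsFiniteMeasure P] [IsFiniteMeasure Q]
    {g : X → ℝ} (hg : Measurable g) {K : ℝ} (hK : ∀ x, |g x| ≤ K) :
    ∫ x, g x ∂P - ∫ x, g x ∂Q ≤ K * tvNorm P Q := by
  obtain ⟨J, hJ⟩ : ∃ J, J = (P.toSignedMeasure - Q.toSignedMeasure).toJordanDecomposition :=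
    ⟨_, rfl⟩
  have hs : J.posPart.toSignedMeasure - J.negPart.toSignedMeasure =
      P.toSignedMeasure - Q.toSignedMeasure := by
    rw [hJ]; exact SignedMeasure.toSignedMeasure_toJordanDecomposition _
  -- Stated as an equality of positive measures, the Jordan decomposition can be integrated against
  -- `g`.
  have heq : P + J.negPart = Q + J.posPart := by
    ext s hs'
    have h1 := congrArg (fun v : SignedMeasure X => v s) hs
    simp only [Measure.toSignedMeasure_sub_apply hs'] at h1
    rw [← measureReal_eq_measureReal_iff, measureReal_add_apply, measureReal_add_apply]
    linarith
  have hint : ∀ (ρ : Measure X) [IsFiniteMeasure ρ], Integrable g ρ := fun ρ _ =>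
    Integrable.of_bound hg.aestronglyMeasurable K (ae_of_all _ hK)
  have h2 := congrArg (fun ρ : Measure X => ∫ x, g x ∂ρ) heq
  simp only [integral_add_measure (hint _) (hint _)] at h2
  have hb : ∀ (ρ : Measure X) [IsFiniteMeasure ρ], |∫ x, g x ∂ρ| ≤ K * ρ.real Set.univ :=
    fun ρ _ => by
      rw [← Real.norm_eq_abs]
      exact norm_integral_le_of_norm_le_const (ae_of_all _ fun x => by
        rw [Real.norm_eq_abs]; exact hK x)
  have ht : tvNorm P Q = J.posPart.real Set.univ + J.negPart.real Set.univ := by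
    rw [tvNorm, SignedMeasure.totalVariation, ← hJ, measureReal_add_apply]
  rw [ht]
  have h3 := (abs_le.1 (hb J.posPart)).2
  have h4 := (abs_le.1 (hb J.negPart)).1
  linarith

theorem tvNorm_nonneg (P Q : Measure X) [IsFiniteMeasure P] [IsFiniteMeasure Q] :
    0 ≤ tvNorm P Q := measureReal_nonneg

theorem tvNorm_self (P : Measure X) [IsFiniteMeasure P] : tvNorm P P = 0 := by
  rw [tvNorm, sub_self, SignedMeasure.totalVariation_zero, measureReal_zero_apply]

/-- `P - Q` is nonpositive on `G` and nonnegative on its complement. Both total masses are `1`, so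
the two parts contribute equally, whence the factor `2`. -/
theorem tvNorm_le_of_subset (P Q : Measure X) [IsProbabilityMeasure P] [IsProbabilityMeasure Q]
    {G : Set X} (hG : MeasurableSet G) (h1 : ∀ s, MeasurableSet s → s ⊆ G → P s ≤ Q s)
    (h2 : ∀ s, MeasurableSet s → s ⊆ Gᶜ → Q s ≤ P s) :
    tvNorm P Q ≤ 2 * (Q.real G - P.real G) := by
  obtain ⟨i, hi, hi0, hi1, hp, hn⟩ :=
    (P.toSignedMeasure - Q.toSignedMeasure).toJordanDecomposition_spec
  have r1 : P.real (i ∩ G) ≤ Q.real (i ∩ G) :=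
    ENNReal.toReal_mono (measure_ne_top _ _) (h1 _ (hi.inter hG) Set.inter_subset_right)
  have r2 : Q.real (Gᶜ \ i) ≤ P.real (Gᶜ \ i) :=
    ENNReal.toReal_mono (measure_ne_top _ _) (h2 _ (hG.compl.diff hi) Set.sdiff_subset)
  have hP1 := measureReal_inter_add_sdiff (μ := P) (s := i) hG
  have hQ1 := measureReal_inter_add_sdiff (μ := Q) (s := i) hG
  have hP2 := measureReal_inter_add_sdiff (μ := P) (s := Gᶜ) hi
  have hQ2 := measureReal_inter_add_sdiff (μ := Q) (s := Gᶜ) hi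
  have e : Gᶜ ∩ i = i \ G := by ext x; simp [and_comm]
  rw [e] at hP2 hQ2
  have hP3 := probReal_compl_eq_one_sub (μ := P) hG
  have hQ3 := probReal_compl_eq_one_sub (μ := Q) hG
  have hP4 := probReal_compl_eq_one_sub (μ := P) hi
  have hQ4 := probReal_compl_eq_one_sub (μ := Q) hi
  rw [tvNorm, SignedMeasure.totalVariation, measureReal_add_apply, hp, hn,
    SignedMeasure.toMeasureOfZeroLE_real_apply _ _ _ MeasurableSet.univ,
    SignedMeasure.toMeasureOfLEZero_real_apply _ _ _ MeasurableSet.univ, Set.inter_univ,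
    Set.inter_univ, Measure.toSignedMeasure_sub_apply hi,
    Measure.toSignedMeasure_sub_apply hi.compl]
  linarith

end TotalVariation

/-! ### Likelihood ratio of diagonal Gaussians -/

section Density

open Set

/-- The ratio is kept as one exponential, so that products over coordinates become sums and
comparison with `1` becomes a sign condition. -/
theorem gaussianReal_map_mul_eq_withDensity {s : ℝ} (hs : 0 < s) :
    (gaussianReal 0 1).map (s * ·) = (gaussianReal 0 1).withDensity fun x =>
      ENNReal.ofReal (Real.exp ((1 - 1 / s ^ 2) * x ^ 2 / 2 - Real.log s)) := by
  have hv : (NNReal.mk (s ^ 2) (sq_nonneg s)) * 1 ≠ 0 := by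
    rw [mul_one]; exact fun h => (pow_pos hs 2).ne' (congrArg NNReal.toReal h)
  rw [gaussianReal_map_const_mul, gaussianReal_of_var_ne_zero _ hv,
    gaussianReal_of_var_ne_zero _ one_ne_zero, ← withDensity_mul _ (by fun_prop) (by fun_prop)]
  congr 1 with x
  rw [Pi.mul_apply, gaussianPDF_def, gaussianPDF_def, ← ENNReal.ofReal_mul (gaussianPDFReal_nonneg _ _ _)]
  simp only [gaussianPDFReal_def, mul_zero, sub_zero, mul_one, NNReal.coe_mk, NNReal.coe_one]
  have key : Real.exp (-x ^ 2 / (2 * s ^ 2)) =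
      Real.exp (-x ^ 2 / 2) * Real.exp ((1 - 1 / s ^ 2) * x ^ 2 / 2) := by
    rw [← Real.exp_add]
    congr 1
    field_simp
    ring
  rw [Real.sqrt_mul (by positivity), Real.sqrt_sq hs.le, Real.exp_sub, Real.exp_log hs, key]
  field_simp

theorem pi_withDensity {ι : Type*} [Fintype ι] {α : ι → Type*} [∀ i, MeasurableSpace (α i)]
    (μ : ∀ i, Measure (α i)) [∀ i, IsProbabilityMeasure (μ i)] {f : ∀ i, α i → ENNReal}
    (hf : ∀ i, Measurable (f i)) [∀ i, SigmaFinite ((μ i).withDensity (f i))] :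
    Measure.pi (fun i => (μ i).withDensity (f i)) =
      (Measure.pi μ).withDensity fun x => ∏ i, f i (x i) := by
  refine Measure.pi_eq fun s hs => ?_
  have hg : ∀ i, Measurable ((s i).indicator (f i)) := fun i => (hf i).indicator (hs i)
  have hind := iIndepFun_pi (μ := μ) (X := fun i => (s i).indicator (f i))
    fun i => (hg i).aemeasurable
  rw [withDensity_apply _ (MeasurableSet.univ_pi hs), ← lintegral_indicator (MeasurableSet.univ_pi hs)]
  have e : (univ.pi s).indicator (fun x : ∀ i, α i => ∏ i, f i (x i)) =
      fun x => ∏ i, (s i).indicator (f i) (x i) := by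
    funext x
    by_cases hx : x ∈ univ.pi s
    · rw [indicator_of_mem hx]
      exact Finset.prod_congr rfl fun i _ => (indicator_of_mem (hx i (mem_univ i)) _).symm
    · rw [indicator_of_notMem hx]
      obtain ⟨i, hi⟩ : ∃ i, x i ∉ s i := by simpa using hx
      exact (Finset.prod_eq_zero (Finset.mem_univ i) (indicator_of_notMem hi _)).symm
  rw [e, lintegral_prod_eq_prod_lintegral_of_indepFun _ _ hind
    fun i => (hg i).comp (measurable_pi_apply i)]
  refine Finset.prod_congr rfl fun i _ => ?_
  rw [withDensity_apply _ (hs i), ← lintegral_indicator (hs i),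
    ← (measurePreserving_eval μ i).lintegral_comp (hg i)]

variable {m : ℕ}

theorem piGaussian_map_mul {s : Fin m → ℝ} (hs : ∀ i, 0 < s i) :
    (piGaussian m).map (fun x i => s i * x i) = (piGaussian m).withDensity fun x =>
      ENNReal.ofReal (Real.exp
        (∑ i, ((1 - 1 / s i ^ 2) * x i ^ 2 / 2 - Real.log (s i)))) := by
  have h1 : ∀ i, (gaussianReal 0 1).map (s i * ·) = (gaussianReal 0 1).withDensity fun x =>
      ENNReal.ofReal (Real.exp ((1 - 1 / s i ^ 2) * x ^ 2 / 2 - Real.log (s i))) := fun i =>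
    gaussianReal_map_mul_eq_withDensity (hs i)
  have hp : ∀ i, IsProbabilityMeasure ((gaussianReal 0 1).map (s i * ·)) := fun i =>
    Measure.isProbabilityMeasure_map (by fun_prop)
  have hσ : ∀ i, SigmaFinite ((gaussianReal 0 1).withDensity fun x =>
      ENNReal.ofReal (Real.exp ((1 - 1 / s i ^ 2) * x ^ 2 / 2 - Real.log (s i)))) := fun i => by
    rw [← h1 i]; infer_instance
  have h2 : (piGaussian m).map (fun x i => s i * x i) =
      Measure.pi fun i => (gaussianReal 0 1).map (s i * ·) :=
    Measure.pi_map_pi (μ := fun _ => gaussianReal 0 1) (f := fun i => (s i * ·))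
      (fun i => by fun_prop)
  rw [h2]
  simp only [h1]
  rw [pi_withDensity _ fun i => by fun_prop]
  congr 1 with x
  rw [← ENNReal.ofReal_prod_of_nonneg fun i _ => (Real.exp_pos _).le, Real.exp_sum]

/-- The region where the density of the Gaussian with standard deviations `s i` is at most the
standard Gaussian density. -/
def densityRegion (s : Fin m → ℝ) : Set (Fin m → ℝ) :=
  {x | ∑ i, (√(1 - 1 / s i ^ 2) * x i) ^ 2 ≤ 2 * ∑ i, Real.log (s i)}

theorem measurableSet_densityRegion (s : Fin m → ℝ) : MeasurableSet (densityRegion s) :=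
  measurableSet_le (by fun_prop) measurable_const

/-- For `s i ≥ 1` the coefficients `1 - 1 / s i ^ 2` are squares, so the region where the ratio is
at most `1` has the form required by `piGaussian_shift_le`. -/
theorem exponent_eq {s : Fin m → ℝ} (hs : ∀ i, 1 ≤ s i) (x : Fin m → ℝ) :
    ∑ i, ((1 - 1 / s i ^ 2) * x i ^ 2 / 2 - Real.log (s i)) =
      (∑ i, (√(1 - 1 / s i ^ 2) * x i) ^ 2 - 2 * ∑ i, Real.log (s i)) / 2 := by
  rw [Finset.mul_sum, ← Finset.sum_sub_distrib, Finset.sum_div]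
  refine Finset.sum_congr rfl fun i _ => ?_
  have h0 : 0 ≤ 1 - 1 / s i ^ 2 := by
    rw [sub_nonneg, div_le_one (by have := hs i; positivity)]
    exact one_le_pow₀ (hs i)
  rw [mul_pow, Real.sq_sqrt h0]
  ring

theorem map_mul_le_of_subset {s : Fin m → ℝ} (hs : ∀ i, 1 ≤ s i) {t : Set (Fin m → ℝ)}
    (ht : MeasurableSet t) (hsub : t ⊆ densityRegion s) :
    (piGaussian m).map (fun x i => s i * x i) t ≤ piGaussian m t := by
  rw [piGaussian_map_mul fun i => zero_lt_one.trans_le (hs i), withDensity_apply _ ht,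
    ← setLIntegral_one]
  refine setLIntegral_mono measurable_const fun x hx => ?_
  rw [exponent_eq hs, ENNReal.ofReal_le_one, Real.exp_le_one_iff]
  have := hsub hx
  rw [densityRegion, mem_ofPred_eq] at this
  linarith

theorem le_map_mul_of_subset_compl {s : Fin m → ℝ} (hs : ∀ i, 1 ≤ s i) {t : Set (Fin m → ℝ)}
    (ht : MeasurableSet t) (hsub : t ⊆ (densityRegion s)ᶜ) :
    piGaussian m t ≤ (piGaussian m).map (fun x i => s i * x i) t := by
  rw [piGaussian_map_mul fun i => zero_lt_one.trans_le (hs i), withDensity_apply _ ht,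
    ← setLIntegral_one]
  refine setLIntegral_mono (by fun_prop) fun x hx => ?_
  rw [exponent_eq hs, ENNReal.one_le_ofReal]
  have := hsub hx
  rw [mem_compl_iff, densityRegion, mem_ofPred_eq] at this
  exact Real.one_le_exp (by linarith)

end Density

/-! ### Pseudoinverse identities and the matrix linking the codes -/

section MatrixFacts

open Matrix

variable {M n m : ℕ}

theorem mul_pinv_sub_one_mul (A : Matrix (Fin M) (Fin n) ℝ) :
    (A * Aᵀ * pinv (A * Aᵀ) - 1) * (A * Aᵀ) = 0 := by
  rw [Matrix.sub_mul, (pinv_spec (A * Aᵀ)).mul_mul_left, Matrix.one_mul, sub_self]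

/-- With `E = AA'(AA')⁺ - 1` one has `(EA)(EA)' = (E AA')E' = 0`, hence `EA = 0`. -/
theorem mul_pinv_mul_cancel (A : Matrix (Fin M) (Fin n) ℝ) :
    A * Aᵀ * pinv (A * Aᵀ) * A = A := by
  have h : ((A * Aᵀ * pinv (A * Aᵀ) - 1) * A) * ((A * Aᵀ * pinv (A * Aᵀ) - 1) * A)ᴴ = 0 := by
    rw [conjTranspose_eq_transpose_of_trivial, transpose_mul, ← Matrix.mul_assoc,
      Matrix.mul_assoc _ A, mul_pinv_sub_one_mul, Matrix.zero_mul]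
  rw [self_mul_conjTranspose_eq_zero, Matrix.sub_mul, Matrix.one_mul, sub_eq_zero] at h
  exact h

theorem mul_pinv_mul_cancel_of_range_le {A : Matrix (Fin M) (Fin n) ℝ}
    {B : Matrix (Fin M) (Fin m) ℝ} (h : LinearMap.range B.mulVecLin ≤ LinearMap.range A.mulVecLin) :
    A * Aᵀ * (pinv (A * Aᵀ) * B) = B := by
  have hX : ∀ j, ∃ x, A *ᵥ x = B *ᵥ Pi.single j 1 := fun j =>
    LinearMap.mem_range.1 (h (LinearMap.mem_range_self B.mulVecLin (Pi.single j 1)))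
  choose X hX using hX
  have hB : A * (of X)ᵀ = B := by
    ext i j
    have := congrFun (hX j) i
    rw [mulVec_single_one] at this
    exact this
  rw [← Matrix.mul_assoc, ← hB, ← Matrix.mul_assoc, mul_pinv_mul_cancel]

/-- The matrix `C` with `C A' = B'` and `C C' = B' (AA')⁺ B`. -/
noncomputable def linkMatrix (A : Matrix (Fin M) (Fin n) ℝ) (B : Matrix (Fin M) (Fin m) ℝ) :
    Matrix (Fin m) (Fin n) ℝ := (pinv (A * Aᵀ) * B)ᵀ * A

theorem linkMatrix_mul_transpose {A : Matrix (Fin M) (Fin n) ℝ} {B : Matrix (Fin M) (Fin m) ℝ}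
    (h : A * Aᵀ * (pinv (A * Aᵀ) * B) = B) : linkMatrix A B * Aᵀ = Bᵀ := by
  conv_rhs => rw [← h]
  rw [linkMatrix, Matrix.mul_assoc, transpose_mul (A * Aᵀ), transpose_mul A, transpose_transpose]

theorem linkMatrix_mul_self_transpose {A : Matrix (Fin M) (Fin n) ℝ}
    {B : Matrix (Fin M) (Fin m) ℝ} (h : A * Aᵀ * (pinv (A * Aᵀ) * B) = B) :
    linkMatrix A B * (linkMatrix A B)ᵀ = Bᵀ * pinv (A * Aᵀ) * B := by
  have e : (linkMatrix A B)ᵀ = Aᵀ * (pinv (A * Aᵀ) * B) := by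
    rw [linkMatrix, transpose_mul, transpose_transpose]
  rw [e, ← Matrix.mul_assoc, linkMatrix_mul_transpose h, ← Matrix.mul_assoc]

/-- For `K = (AA')⁺A`, the parameter `β = Kx` has mean `Cx` in the second code; the priors of the
lower bound live on such parameters. -/
theorem linkMatrix_mul_proj {A : Matrix (Fin M) (Fin n) ℝ} {B : Matrix (Fin M) (Fin m) ℝ}
    (h : A * Aᵀ * (pinv (A * Aᵀ) * B) = B) :
    Bᵀ * (pinv (A * Aᵀ) * A) = linkMatrix A B := by
  rw [← linkMatrix_mul_transpose h, linkMatrix]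
  simp only [Matrix.mul_assoc]
  congr 1
  simpa only [Matrix.mul_assoc] using mul_pinv_mul_cancel A

theorem posSemidef_self_mul_transpose {p q : ℕ} (C : Matrix (Fin p) (Fin q) ℝ) :
    (C * Cᵀ).PosSemidef := by
  rw [← conjTranspose_eq_transpose_of_trivial]
  exact posSemidef_self_mul_conjTranspose C

/-- Simultaneous diagonalisation of `S` and `S ∨ I`. -/
theorem exists_diagonalization {S : Matrix (Fin m) (Fin m) ℝ} (hS : S.PosSemidef) :
    ∃ (U : Matrix (Fin m) (Fin m) ℝ) (l : Fin m → ℝ), Uᵀ * U = 1 ∧ U * Uᵀ = 1 ∧ (∀ i, 0 ≤ l i) ∧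
      S = U * diagonal l * Uᵀ ∧ supOne S = U * diagonal (fun i => max (l i) 1) * Uᵀ := by
  have hH := hS.isHermitian
  refine ⟨hH.eigenvectorUnitary, hH.eigenvalues, ?_, ?_, hS.eigenvalues_nonneg, ?_,
    supOne_eq hH⟩
  · have := Unitary.coe_star_mul_self hH.eigenvectorUnitary
    rwa [star_eq_conjTranspose, conjTranspose_eq_transpose_of_trivial] at this
  · have := Unitary.coe_mul_star_self hH.eigenvectorUnitary
    rwa [Unitary.coe_star, star_eq_conjTranspose, conjTranspose_eq_transpose_of_trivial] at this
  · have := hH.spectral_theorem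
    rw [Unitary.conjStarAlgAut_apply, star_eq_conjTranspose,
      conjTranspose_eq_transpose_of_trivial] at this
    exact this

theorem diagonal_sqrt_mul_transpose {U : Matrix (Fin m) (Fin m) ℝ} {l : Fin m → ℝ}
    (hl : ∀ i, 0 ≤ l i) :
    U * diagonal (fun i => √(l i)) * (U * diagonal fun i => √(l i))ᵀ = U * diagonal l * Uᵀ := by
  rw [transpose_mul, diagonal_transpose, Matrix.mul_assoc, ← Matrix.mul_assoc (diagonal _),
    diagonal_mul_diagonal, ← Matrix.mul_assoc]
  simp only [Real.mul_self_sqrt (hl _)]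

/-- With `E = AA'(AA')⁺ - 1`, the matrix `E(AA' - BB')E' = -(EB)(EB)'` is positive semidefinite, so
its trace forces `EB = 0`. -/
theorem mul_pinv_mul_cancel_of_posSemidef {A : Matrix (Fin M) (Fin n) ℝ}
    {B : Matrix (Fin M) (Fin m) ℝ} (h : (A * Aᵀ - B * Bᵀ).PosSemidef) :
    A * Aᵀ * (pinv (A * Aᵀ) * B) = B := by
  obtain ⟨E, hE⟩ : ∃ E, E = A * Aᵀ * pinv (A * Aᵀ) - 1 := ⟨_, rfl⟩
  have h1 := (h.mul_mul_conjTranspose_same E).trace_nonneg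
  have h2 : E * (A * Aᵀ - B * Bᵀ) * Eᴴ = -((E * B) * (E * B)ᴴ) := by
    have h3 : E * (A * Aᵀ) = 0 := by rw [hE]; exact mul_pinv_sub_one_mul A
    rw [Matrix.mul_sub, h3, zero_sub, conjTranspose_mul, ← Matrix.mul_assoc, Matrix.neg_mul,
      conjTranspose_eq_transpose_of_trivial B]
    simp only [Matrix.mul_assoc]
  rw [h2, trace_neg] at h1
  have h3 := (posSemidef_self_mul_conjTranspose (E * B)).trace_nonneg
  have h4 : E * B = 0 := trace_mul_conjTranspose_self_eq_zero_iff.1 (by linarith)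
  rw [hE, Matrix.sub_mul, Matrix.one_mul, sub_eq_zero, Matrix.mul_assoc] at h4
  exact h4

theorem supOne_eq_one_of_posSemidef {A : Matrix (Fin M) (Fin n) ℝ} {B : Matrix (Fin M) (Fin m) ℝ}
    (h : (A * Aᵀ - B * Bᵀ).PosSemidef) : supOne (Bᵀ * pinv (A * Aᵀ) * B) = 1 := by
  have hB := mul_pinv_mul_cancel_of_posSemidef h
  obtain ⟨S, hS⟩ : ∃ S, S = Bᵀ * pinv (A * Aᵀ) * B := ⟨_, rfl⟩
  obtain ⟨Y, hY⟩ : ∃ Y, Y = pinv (A * Aᵀ) * B := ⟨_, rfl⟩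
  rw [← hY] at hB
  have hSC : S = linkMatrix A B * (linkMatrix A B)ᵀ := by
    rw [hS, linkMatrix_mul_self_transpose (mul_pinv_mul_cancel_of_posSemidef h)]
  have hSp : S.PosSemidef := hSC ▸ posSemidef_self_mul_transpose _
  have hSt : Sᵀ = S := by
    rw [← conjTranspose_eq_transpose_of_trivial]; exact hSp.isHermitian
  have hBY : Bᵀ * Y = S := by rw [hS, hY, Matrix.mul_assoc]
  have hYB : Yᵀ * B = S := by
    rw [← hSt, ← hBY, transpose_mul, transpose_transpose]
  -- Conjugating `AA' - BB'` by `Y = (AA')⁺B` gives `S - S²`; thus `l - l² ≥ 0`, that is `l ≤ 1`,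
  -- for each eigenvalue.
  have hd : (S - S * S).PosSemidef := by
    have := h.conjTranspose_mul_mul_same Y
    rw [conjTranspose_eq_transpose_of_trivial, Matrix.mul_sub, Matrix.sub_mul, Matrix.mul_assoc,
      hB, ← Matrix.mul_assoc, hYB, Matrix.mul_assoc, hBY] at this
    exact this
  obtain ⟨U, l, hU1, hU2, -, hSU, hsup⟩ := exists_diagonalization hSp
  have hl : ∀ i, l i ≤ 1 := by
    intro i
    have h1 := hd.conjTranspose_mul_mul_same U
    have h2 : Uᴴ * (S - S * S) * U = diagonal fun i => l i - l i * l i := by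
      have h3 : Uᵀ * S * U = diagonal l := by
        rw [hSU, Matrix.mul_assoc, Matrix.mul_assoc, hU1, ← Matrix.mul_assoc, ← Matrix.mul_assoc,
          hU1, Matrix.one_mul, Matrix.mul_one]
      have h4 : Uᵀ * (S * S) * U = (Uᵀ * S * U) * (Uᵀ * S * U) := by
        calc Uᵀ * (S * S) * U = Uᵀ * (S * 1 * S) * U := by rw [Matrix.mul_one]
          _ = _ := by rw [← hU2]; simp only [Matrix.mul_assoc]
      rw [conjTranspose_eq_transpose_of_trivial, Matrix.mul_sub, Matrix.sub_mul, h4, h3,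
        diagonal_mul_diagonal, diagonal_sub]
    rw [h2, posSemidef_diagonal_iff] at h1
    nlinarith [h1 i]
  rw [← hS, hsup]
  simp only [max_eq_right (hl _)]
  rw [show (diagonal fun _ : Fin m => (1 : ℝ)) = 1 from diagonal_one, Matrix.mul_one, hU2]

end MatrixFacts

/-! ### Linear images of Gaussian measures -/

section Gaussian

open Matrix

/-- Multiplication by a matrix, between Euclidean spaces. -/
noncomputable def euclMul {p q : ℕ} (T : Matrix (Fin q) (Fin p) ℝ) :
    EuclideanSpace ℝ (Fin p) →L[ℝ] EuclideanSpace ℝ (Fin q) :=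
  LinearMap.toContinuousLinearMap (toLpLin 2 2 T)

variable {p q r : ℕ}

theorem euclMul_apply (T : Matrix (Fin q) (Fin p) ℝ) (x : EuclideanSpace ℝ (Fin p)) :
    euclMul T x = WithLp.toLp 2 (T *ᵥ x.ofLp) := rfl

theorem euclMul_mul (T : Matrix (Fin q) (Fin p) ℝ) (T' : Matrix (Fin p) (Fin r) ℝ)
    (x : EuclideanSpace ℝ (Fin r)) : euclMul (T * T') x = euclMul T (euclMul T' x) := by
  simp only [euclMul_apply, mulVec_mulVec]

theorem euclMul_one (x : EuclideanSpace ℝ (Fin p)) : euclMul 1 x = x := by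
  simp only [euclMul_apply, one_mulVec, WithLp.toLp_ofLp]

theorem euclMul_smul (c : ℝ) (T : Matrix (Fin q) (Fin p) ℝ) (x : EuclideanSpace ℝ (Fin p)) :
    euclMul (c • T) x = c • euclMul T x := by
  simp only [euclMul_apply, smul_mulVec, WithLp.toLp_smul]

theorem inner_euclMul_left (T : Matrix (Fin q) (Fin p) ℝ) (x : EuclideanSpace ℝ (Fin p))
    (y : EuclideanSpace ℝ (Fin q)) : inner ℝ (euclMul T x) y = inner ℝ x (euclMul Tᵀ y) := by
  simp only [euclMul_apply, EuclideanSpace.inner_eq_star_dotProduct, star_trivial]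
  rw [mulVec_transpose, dotProduct_mulVec]

theorem charFun_map_euclMul (μ : Measure (EuclideanSpace ℝ (Fin p)))
    (T : Matrix (Fin q) (Fin p) ℝ) (t : EuclideanSpace ℝ (Fin q)) :
    charFun (μ.map (euclMul T)) t = charFun μ (euclMul Tᵀ t) := by
  rw [charFun_apply, charFun_apply, integral_map (by fun_prop) (by fun_prop)]
  simp only [inner_euclMul_left]

theorem norm_euclMul_transpose_sq (T : Matrix (Fin q) (Fin p) ℝ) (t : EuclideanSpace ℝ (Fin q)) :
    ‖euclMul Tᵀ t‖ ^ 2 = t.ofLp ⬝ᵥ (T * Tᵀ) *ᵥ t.ofLp := by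
  rw [← real_inner_self_eq_norm_sq, inner_euclMul_left, transpose_transpose, ← euclMul_mul,
    euclMul_apply, EuclideanSpace.inner_eq_star_dotProduct, star_trivial, dotProduct_comm]

theorem stdGaussian_map_euclMul (T : Matrix (Fin q) (Fin p) ℝ) :
    (stdGaussian (EuclideanSpace ℝ (Fin p))).map (euclMul T) =
      multivariateGaussian 0 (T * Tᵀ) := by
  refine Measure.ext_of_charFun (funext fun t => ?_)
  rw [charFun_map_euclMul, charFun_stdGaussian,
    charFun_multivariateGaussian (posSemidef_self_mul_transpose T), ← norm_euclMul_transpose_sq,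
    inner_zero_right]
  congr 1
  push_cast
  ring

/-- The law of `P x + Q y` for independent standard Gaussian `x` and `y`. -/
theorem map_euclMul_add_euclMul (P : Matrix (Fin r) (Fin p) ℝ) (Q : Matrix (Fin r) (Fin q) ℝ) :
    ((stdGaussian (EuclideanSpace ℝ (Fin p))).prod (stdGaussian (EuclideanSpace ℝ (Fin q)))).map
      (fun v => euclMul P v.1 + euclMul Q v.2) = multivariateGaussian 0 (P * Pᵀ + Q * Qᵀ) := by
  have hconv : ((stdGaussian (EuclideanSpace ℝ (Fin p))).prod
      (stdGaussian (EuclideanSpace ℝ (Fin q)))).map (fun v => euclMul P v.1 + euclMul Q v.2) =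
      ((stdGaussian (EuclideanSpace ℝ (Fin p))).map (euclMul P)).conv
        ((stdGaussian (EuclideanSpace ℝ (Fin q))).map (euclMul Q)) := by
    rw [Measure.conv, Measure.map_prod_map _ _ (by fun_prop) (by fun_prop),
      Measure.map_map (by fun_prop) (by fun_prop)]
    rfl
  rw [hconv]
  refine Measure.ext_of_charFun (funext fun t => ?_)
  rw [charFun_conv, stdGaussian_map_euclMul, stdGaussian_map_euclMul,
    charFun_multivariateGaussian (posSemidef_self_mul_transpose P),
    charFun_multivariateGaussian (posSemidef_self_mul_transpose Q),
    charFun_multivariateGaussian ((posSemidef_self_mul_transpose P).add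
      (posSemidef_self_mul_transpose Q)), inner_zero_right, ← Complex.exp_add, add_mulVec,
    dotProduct_add]
  congr 1
  push_cast
  ring

theorem multivariateGaussian_eq_map_add (b : EuclideanSpace ℝ (Fin p))
    (T : Matrix (Fin p) (Fin p) ℝ) :
    multivariateGaussian b T = (multivariateGaussian 0 T).map (b + ·) := by
  rw [multivariateGaussian, multivariateGaussian, Measure.map_map (by fun_prop) (by fun_prop)]
  congr 1 with x
  simp

theorem multivariateGaussian_smul_one (b : EuclideanSpace ℝ (Fin p)) (σ : ℝ) :
    multivariateGaussian b (σ ^ 2 • (1 : Matrix (Fin p) (Fin p) ℝ)) =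
      (stdGaussian (EuclideanSpace ℝ (Fin p))).map (fun x => b + σ • x) := by
  have h := stdGaussian_map_euclMul (σ • (1 : Matrix (Fin p) (Fin p) ℝ))
  rw [transpose_smul, transpose_one, smul_mul_smul_comm, Matrix.mul_one, ← pow_two] at h
  rw [multivariateGaussian_eq_map_add, ← h, Measure.map_map (by fun_prop) (by fun_prop)]
  congr 1 with x
  simp [euclMul_smul, euclMul_one]

variable {M n : ℕ}

/-- The mean `A'β`. -/
noncomputable def codeMean (A : Matrix (Fin M) (Fin n) ℝ) (β : Fin M → ℝ) :
    EuclideanSpace ℝ (Fin n) := WithLp.toLp 2 (Aᵀ *ᵥ β)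

theorem codeExperiment_law (A : Matrix (Fin M) (Fin n) ℝ) (σ : ℝ) (β : Fin M → ℝ) :
    (codeExperiment A σ).law β =
      (stdGaussian (EuclideanSpace ℝ (Fin n))).map (fun x => codeMean A β + σ • x) :=
  multivariateGaussian_smul_one _ σ

end Gaussian

/-! ### Upper bound for the deficiency -/

section UpperBound

open Matrix

variable {M n m : ℕ}

/-- The kernel `z ↦ C z + σ R w` with a standard Gaussian `w`. -/
noncomputable def noiseKernel (C : Matrix (Fin m) (Fin n) ℝ) (R : Matrix (Fin m) (Fin m) ℝ)
    (σ : ℝ) : Kernel (EuclideanSpace ℝ (Fin n)) (EuclideanSpace ℝ (Fin m)) :=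
  (Kernel.id ×ₖ Kernel.const _ (stdGaussian (EuclideanSpace ℝ (Fin m)))).map
    fun v => euclMul C v.1 + σ • euclMul R v.2

theorem isMarkovKernel_noiseKernel (C : Matrix (Fin m) (Fin n) ℝ) (R : Matrix (Fin m) (Fin m) ℝ)
    (σ : ℝ) : IsMarkovKernel (noiseKernel C R σ) :=
  Kernel.IsMarkovKernel.map _ (by fun_prop)

theorem noiseKernel_apply (C : Matrix (Fin m) (Fin n) ℝ) (R : Matrix (Fin m) (Fin m) ℝ)
    (σ : ℝ) (z : EuclideanSpace ℝ (Fin n)) :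
    noiseKernel C R σ z = (stdGaussian (EuclideanSpace ℝ (Fin m))).map
      fun w => euclMul C z + σ • euclMul R w := by
  rw [noiseKernel, Kernel.map_apply _ (by fun_prop), Kernel.prod_apply, Kernel.id_apply,
    Kernel.const_apply, Measure.dirac_prod, Measure.map_map (by fun_prop) (by fun_prop)]
  rfl

/-- `R` shapes the extra noise: the variances missing along the eigenvectors are `max l 1 - l ≥ 0`.
-/
theorem exists_noise_factor {S : Matrix (Fin m) (Fin m) ℝ} (hS : S.PosSemidef) :
    ∃ R : Matrix (Fin m) (Fin m) ℝ, S + R * Rᵀ = supOne S := by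
  obtain ⟨U, l, -, -, -, hSU, hsup⟩ := exists_diagonalization hS
  refine ⟨U * diagonal fun i => √(max (l i) 1 - l i), ?_⟩
  rw [diagonal_sqrt_mul_transpose fun i => sub_nonneg.2 (le_max_left _ _), hsup]
  nth_rw 1 [hSU]
  rw [← Matrix.add_mul, ← Matrix.mul_add, diagonal_add]
  simp only [add_sub_cancel]

theorem euclMul_codeMean {A : Matrix (Fin M) (Fin n) ℝ} {B : Matrix (Fin M) (Fin m) ℝ}
    {C : Matrix (Fin m) (Fin n) ℝ} (h : C * Aᵀ = Bᵀ) (β : Fin M → ℝ) :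
    euclMul C (codeMean A β) = codeMean B β := by
  rw [euclMul_apply, codeMean, codeMean, mulVec_mulVec, h]

theorem isDeficient_tvNorm {A : Matrix (Fin M) (Fin n) ℝ} {B : Matrix (Fin M) (Fin m) ℝ}
    {C : Matrix (Fin m) (Fin n) ℝ} (h : C * Aᵀ = Bᵀ) (σ : ℝ) :
    IsDeficient (fun _ => tvNorm (multivariateGaussian 0 (supOne (C * Cᵀ)))
        (multivariateGaussian 0 (1 : Matrix (Fin m) (Fin m) ℝ)))
      (codeExperiment A σ) (codeExperiment B σ) := by
  intro Θ₀ D _ L hLm hLb ρ hρ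
  obtain ⟨R, hR⟩ := exists_noise_factor (posSemidef_self_mul_transpose C)
  have := isMarkovKernel_noiseKernel C R σ
  -- The observation is first turned into a vector of mean `B'β` and covariance `σ²(CC' ∨ I)`, then
  -- `ρ` is applied; this choice depends neither on `β` nor on the loss.
  refine ⟨ρ ∘ₖ noiseKernel C R σ, inferInstance, fun β _ => ?_⟩
  obtain ⟨K, hK⟩ : ∃ K, K = ⨆ y, |L β y| := ⟨_, rfl⟩
  have hLK : ∀ y, |L β y| ≤ K := fun y => hK ▸ le_ciSup (hLb β) y
  have hLint : ∀ (μ : Measure D) [IsFiniteMeasure μ], Integrable (L β) μ := fun μ _ =>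
    Integrable.of_bound (hLm β).aestronglyMeasurable K (ae_of_all _ hLK)
  let g : EuclideanSpace ℝ (Fin m) → ℝ := fun y => ∫ y', L β y' ∂ρ y
  have hgm : Measurable g := (hLm β).stronglyMeasurable.integral_kernel.measurable
  have hgK : ∀ y, |g y| ≤ K := fun y => by
    have := norm_integral_le_of_norm_le_const (μ := ρ y) (f := L β) (C := K)
      (ae_of_all _ fun y => by rw [Real.norm_eq_abs]; exact hLK y)
    rwa [probReal_univ, mul_one, Real.norm_eq_abs] at this
  have hF : risk (codeExperiment B σ) L ρ β =
      ∫ x, g (codeMean B β + σ • x) ∂multivariateGaussian 0 1 := by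
    rw [risk, codeExperiment_law, integral_map (by fun_prop) hgm.aestronglyMeasurable,
      multivariateGaussian_zero_one]
  have hE : risk (codeExperiment A σ) L (ρ ∘ₖ noiseKernel C R σ) β =
      ∫ x, g (codeMean B β + σ • x) ∂multivariateGaussian 0 (supOne (C * Cᵀ)) := by
    have h1 : ∀ z, ∫ y, L β y ∂(ρ ∘ₖ noiseKernel C R σ) z =
        ∫ w, g (euclMul C z + σ • euclMul R w) ∂stdGaussian (EuclideanSpace ℝ (Fin m)) := by
      intro z
      rw [Kernel.integral_comp (hLint _), noiseKernel_apply,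
        integral_map (by fun_prop) hgm.aestronglyMeasurable]
    have hm : Measurable fun v : EuclideanSpace ℝ (Fin n) × EuclideanSpace ℝ (Fin m) =>
        g (codeMean B β + σ • (euclMul C v.1 + euclMul R v.2)) := hgm.comp (by fun_prop)
    have hg2 : Measurable fun x => g (codeMean B β + σ • x) := hgm.comp (by fun_prop)
    rw [risk, ← hR, ← map_euclMul_add_euclMul C R,
      integral_map (by fun_prop) hg2.aestronglyMeasurable,
      integral_prod _ (Integrable.of_bound hm.aestronglyMeasurable K (ae_of_all _ fun v => hgK _)),
      codeExperiment_law]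
    simp only [h1]
    rw [integral_map (by fun_prop)]
    · congr 1 with x
      congr 1 with w
      rw [map_add, map_smul, euclMul_codeMean h, smul_add, add_assoc]
    · exact (StronglyMeasurable.integral_prod_right (ν := stdGaussian (EuclideanSpace ℝ (Fin m)))
        (f := fun z w => g (euclMul C z + σ • euclMul R w))
        (Measurable.stronglyMeasurable (hgm.comp (by fun_prop)))).aestronglyMeasurable
  rw [hE, hF, ← hK, mul_comm]
  have := integral_sub_integral_le_tvNorm (multivariateGaussian 0 (supOne (C * Cᵀ)))
    (multivariateGaussian 0 (1 : Matrix (Fin m) (Fin m) ℝ))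
    (g := fun x => g (codeMean B β + σ • x)) (hgm.comp (by fun_prop)) fun x => hgK _
  linarith

end UpperBound

/-! ### From deficiency to deterministic decoders -/

section Decoders

variable {M n m : ℕ}

/-- The first coordinate is a nondegenerate real Gaussian; for `n = 0` the law would be a point
mass. -/
theorem nullSingletonClass_codeExperiment (hn : 0 < n) (A : Matrix (Fin M) (Fin n) ℝ) {σ : ℝ}
    (hσ : 0 < σ) (β : Fin M → ℝ) : NullSingletonClass ((codeExperiment A σ).law β) := by
  refine ⟨fun x => ?_⟩
  have hp : (σ ^ 2 • (1 : Matrix (Fin n) (Fin n) ℝ)).PosSemidef :=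
    Matrix.PosSemidef.one.smul (sq_nonneg σ)
  have h := measurePreserving_eval_multivariateGaussian
    (μ := WithLp.toLp 2 (A.transpose.mulVec β)) hp (i := ⟨0, hn⟩)
  have hv : ((σ ^ 2 • (1 : Matrix (Fin n) (Fin n) ℝ)) ⟨0, hn⟩ ⟨0, hn⟩).toNNReal ≠ 0 := by
    simpa using hσ.ne'
  have := nullSingletonClass_gaussianReal (μ := (WithLp.toLp 2 (A.transpose.mulVec β)) ⟨0, hn⟩) hv
  refine measure_mono_null (t := (fun y : EuclideanSpace ℝ (Fin n) => y ⟨0, hn⟩) ⁻¹' {x ⟨0, hn⟩})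
    (by rintro _ rfl; rfl) ?_
  have h2 := h.measure_preimage (measurableSet_singleton (x ⟨0, hn⟩)).nullMeasurableSet
  rw [measure_singleton] at h2
  exact h2

/-- A deficiency bound yields nonrandomized decoders. -/
theorem exists_decoder_of_isDeficient (hn : 0 < n) {A : Matrix (Fin M) (Fin n) ℝ}
    {B : Matrix (Fin M) (Fin m) ℝ} {σ ε : ℝ} (hσ : 0 < σ) (hε : 0 ≤ ε)
    (h : IsDeficient (fun _ => ε) (codeExperiment A σ) (codeExperiment B σ))
    {dB : EuclideanSpace ℝ (Fin m) → Fin M} (hdB : Measurable dB) :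
    ∃ dA : EuclideanSpace ℝ (Fin n) → Fin M, Measurable dA ∧
      ∀ i, packetErrorProb A σ dA i - packetErrorProb B σ dB i ≤ ε := by
  have : Nonempty (Fin M) := ⟨dB 0⟩
  -- The loss must be defined on all of `ℝ^M`; only its values at the `e_i`, where it is the error
  -- indicator, matter.
  let L : (Fin M → ℝ) → Fin M → ℝ := fun β y => ({Pi.single y 1}ᶜ : Set (Fin M → ℝ)).indicator 1 β
  have hL1 : ∀ β y, |L β y| ≤ 1 := fun β y => by
    by_cases hβ : β = Pi.single y 1 <;> simp [L, hβ]
  have hLi : ∀ i y, L (Pi.single i 1) y = ({i}ᶜ : Set (Fin M)).indicator 1 y := fun i y => by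
    by_cases hiy : y = i
    · simp [L, hiy]
    · have : (Pi.single i 1 : Fin M → ℝ) ≠ Pi.single y 1 := fun he => by
        have := congrFun he i
        simp [Ne.symm hiy] at this
      simp [L, hiy, this]
  obtain ⟨τ, hτ, hr⟩ := h Set.univ (Fin M) L (fun _ => Measurable.of_discrete)
    (fun β => ⟨1, by rintro _ ⟨y, rfl⟩; exact hL1 β y⟩) (Kernel.deterministic dB hdB) inferInstance
  have hint : ∀ i (μ : Measure (Fin M)), ∫ y, L (Pi.single i 1) y ∂μ = μ.real {i}ᶜ := fun i μ => by
    simp only [hLi]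
    exact integral_indicator_one (measurableSet_singleton i).compl
  have hprob := (codeExperiment A σ).isProbabilityMeasure
  have hprobB := (codeExperiment B σ).isProbabilityMeasure
  have hnull := fun β => nullSingletonClass_codeExperiment hn A hσ β
  obtain ⟨d, hd, hdi⟩ := exists_measurable_decision
    (fun i => (codeExperiment A σ).law (Pi.single i 1)) τ
  refine ⟨d, hd, fun i => ?_⟩
  have hA : packetErrorProb A σ d i = risk (codeExperiment A σ) L τ (Pi.single i 1) := by
    have hm : Measurable fun x => (τ x).real {i} :=
      (τ.measurable_coe (measurableSet_singleton i)).ennreal_toReal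
    have hi : Integrable (fun x => (τ x).real {i}) ((codeExperiment A σ).law (Pi.single i 1)) :=
      Integrable.of_bound hm.aestronglyMeasurable 1 (ae_of_all _ fun x => by
        rw [Real.norm_eq_abs, abs_of_nonneg measureReal_nonneg]; exact measureReal_le_one)
    rw [packetErrorProb, risk]
    simp only [hint, probReal_compl_eq_one_sub (measurableSet_singleton i)]
    rw [integral_sub (integrable_const _) hi, ← hdi, integral_const, probReal_univ, one_smul,
      ← probReal_compl_eq_one_sub (hd (measurableSet_singleton i))]
    rfl
  have hB : packetErrorProb B σ dB i =
      risk (codeExperiment B σ) L (Kernel.deterministic dB hdB) (Pi.single i 1) := by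
    rw [packetErrorProb, risk]
    simp only [Kernel.integral_deterministic, hLi]
    exact (integral_indicator_one (hdB (measurableSet_singleton i).compl)).symm
  have hs : ⨆ y, |L (Pi.single i 1) y| ≤ 1 := ciSup_le fun y => hL1 _ y
  have := hr (Pi.single i 1) (Set.mem_univ _)
  rw [hA, hB]
  nlinarith

end Decoders

/-! ### Bayes bound under Gaussian priors -/

section LowerBound

open Matrix

variable {M n m : ℕ}

theorem piGaussian_map_euclMul (U : Matrix (Fin m) (Fin m) ℝ) (s : Fin m → ℝ) :
    (piGaussian m).map (fun ξ => euclMul U (WithLp.toLp 2 fun i => s i * ξ i)) =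
      multivariateGaussian 0 (U * diagonal (fun i => s i ^ 2) * Uᵀ) := by
  have h := stdGaussian_map_euclMul (U * diagonal s)
  rw [← map_pi_eq_stdGaussian, Measure.map_map (by fun_prop) (by fun_prop)] at h
  have h1 : U * diagonal s * (U * diagonal s)ᵀ = U * diagonal (fun i => s i ^ 2) * Uᵀ := by
    rw [transpose_mul, diagonal_transpose, Matrix.mul_assoc, ← Matrix.mul_assoc (diagonal s),
      diagonal_mul_diagonal, ← Matrix.mul_assoc]
    simp only [pow_two]
  rw [← h1, ← h]
  congr 1 with ξ : 1
  rw [Function.comp_apply, euclMul_mul]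
  congr 1
  rw [euclMul_apply]
  congr 1
  funext i
  rw [mulVec_diagonal]

/-- The region of `densityRegion`, in the orthonormal coordinates given by `U`. -/
def rotatedRegion (U : Matrix (Fin m) (Fin m) ℝ) (s : Fin m → ℝ) :
    Set (EuclideanSpace ℝ (Fin m)) :=
  {x | (euclMul Uᵀ x).ofLp ∈ densityRegion s}

theorem measurableSet_rotatedRegion (U : Matrix (Fin m) (Fin m) ℝ) (s : Fin m → ℝ) :
    MeasurableSet (rotatedRegion U s) :=
  (measurableSet_densityRegion s).preimage (by fun_prop)

theorem mem_rotatedRegion_iff {U : Matrix (Fin m) (Fin m) ℝ} (hU : Uᵀ * U = 1) {s : Fin m → ℝ}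
    (x : Fin m → ℝ) : euclMul U (WithLp.toLp 2 x) ∈ rotatedRegion U s ↔ x ∈ densityRegion s := by
  rw [rotatedRegion, Set.mem_ofPred_eq, ← euclMul_mul, hU, euclMul_one]

theorem tvNorm_le_rotatedRegion {U : Matrix (Fin m) (Fin m) ℝ} (hU : Uᵀ * U = 1)
    (hU' : U * Uᵀ = 1) {s : Fin m → ℝ} (hs : ∀ i, 1 ≤ s i) :
    tvNorm (multivariateGaussian 0 (U * diagonal (fun i => s i ^ 2) * Uᵀ))
        (multivariateGaussian 0 (1 : Matrix (Fin m) (Fin m) ℝ)) ≤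
      2 * ((multivariateGaussian 0 (1 : Matrix (Fin m) (Fin m) ℝ)).real (rotatedRegion U s) -
        (multivariateGaussian 0 (U * diagonal (fun i => s i ^ 2) * Uᵀ)).real
          (rotatedRegion U s)) := by
  have hφ : Measurable fun ξ : Fin m → ℝ => euclMul U (WithLp.toLp 2 ξ) := by fun_prop
  have hP : multivariateGaussian 0 (U * diagonal (fun i => s i ^ 2) * Uᵀ) =
      ((piGaussian m).map fun ξ i => s i * ξ i).map fun ξ => euclMul U (WithLp.toLp 2 ξ) := by
    rw [← piGaussian_map_euclMul, Measure.map_map hφ (by fun_prop)]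
    rfl
  have hQ : multivariateGaussian 0 (1 : Matrix (Fin m) (Fin m) ℝ) =
      (piGaussian m).map fun ξ => euclMul U (WithLp.toLp 2 ξ) := by
    have := piGaussian_map_euclMul U fun _ => 1
    simp only [one_pow, one_mul] at this
    rw [this, show (diagonal fun _ : Fin m => (1 : ℝ)) = 1 from diagonal_one, Matrix.mul_one, hU']
  refine tvNorm_le_of_subset _ _ (measurableSet_rotatedRegion U s) ?_ ?_
  · intro t ht hsub
    rw [hP, hQ, Measure.map_apply hφ ht, Measure.map_apply hφ ht]
    exact map_mul_le_of_subset hs (hφ ht) fun ξ hξ => (mem_rotatedRegion_iff hU ξ).1 (hsub hξ)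
  · intro t ht hsub
    rw [hP, hQ, Measure.map_apply hφ ht, Measure.map_apply hφ ht]
    exact le_map_mul_of_subset_compl hs (hφ ht) fun ξ hξ hmem =>
      hsub hξ ((mem_rotatedRegion_iff hU ξ).2 hmem)

theorem multivariateGaussian_shift_le {U : Matrix (Fin m) (Fin m) ℝ} (hU : Uᵀ * U = 1)
    (s t : Fin m → ℝ) (a : EuclideanSpace ℝ (Fin m)) :
    multivariateGaussian 0 (U * diagonal (fun i => t i ^ 2) * Uᵀ)
        {w | a - w ∈ rotatedRegion U s} ≤
      piGaussian m {ξ | ∑ i, (√(1 - 1 / s i ^ 2) * t i * ξ i) ^ 2 ≤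
        2 * ∑ i, Real.log (s i)} := by
  have hm : MeasurableSet {w | a - w ∈ rotatedRegion U s} :=
    (measurableSet_rotatedRegion U s).preimage (by fun_prop : Measurable fun w => a - w)
  rw [← piGaussian_map_euclMul, Measure.map_apply (by fun_prop) hm]
  refine le_trans (le_of_eq ?_) (piGaussian_shift_le (fun i => √(1 - 1 / s i ^ 2) * t i)
    (fun i => -(√(1 - 1 / s i ^ 2) * euclMul Uᵀ a i)) _)
  congr 1 with ξ
  rw [Set.mem_preimage, Set.mem_ofPred_eq, rotatedRegion, Set.mem_ofPred_eq, map_sub,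
    ← euclMul_mul, hU, euclMul_one, densityRegion, Set.mem_ofPred_eq, Set.mem_ofPred_eq]
  refine Eq.to_iff (congrArg (· ≤ _) (Finset.sum_congr rfl fun i _ => ?_))
  rw [WithLp.ofLp_sub, Pi.sub_apply]
  ring

theorem charFun_map_toLp_prodMk {Ω E F : Type*} [MeasurableSpace Ω] [NormedAddCommGroup E]
    [InnerProductSpace ℝ E] [NormedAddCommGroup F] [InnerProductSpace ℝ F] [MeasurableSpace E]
    [BorelSpace E] [SecondCountableTopology E] [MeasurableSpace F] [BorelSpace F]
    [SecondCountableTopology F] (μ : Measure Ω) {f : Ω → E} {g : Ω → F} (hf : Measurable f)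
    (hg : Measurable g) (t : WithLp 2 (E × F)) :
    charFun ((μ.map fun v => (f v, g v)).map (WithLp.toLp 2)) t =
      ∫ v, Complex.exp (((inner ℝ (f v) t.ofLp.1 + inner ℝ (g v) t.ofLp.2 : ℝ) : ℂ) *
        Complex.I) ∂μ := by
  rw [Measure.map_map (by fun_prop) (by fun_prop), charFun_apply,
    integral_map (by fun_prop) (by fun_prop)]
  rfl

/-- Uncorrelated linear images of a standard Gaussian pair are independent. -/
theorem map_prodMk_eq_prod {p q r k : ℕ} (P₁ : Matrix (Fin r) (Fin p) ℝ)
    (P₂ : Matrix (Fin r) (Fin q) ℝ) (Q₁ : Matrix (Fin k) (Fin p) ℝ)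
    (Q₂ : Matrix (Fin k) (Fin q) ℝ) (h : P₁ * Q₁ᵀ + P₂ * Q₂ᵀ = 0) :
    ((stdGaussian (EuclideanSpace ℝ (Fin p))).prod (stdGaussian (EuclideanSpace ℝ (Fin q)))).map
      (fun v => (euclMul P₁ v.1 + euclMul P₂ v.2, euclMul Q₁ v.1 + euclMul Q₂ v.2)) =
    (multivariateGaussian 0 (P₁ * P₁ᵀ + P₂ * P₂ᵀ)).prod
      (multivariateGaussian 0 (Q₁ * Q₁ᵀ + Q₂ * Q₂ᵀ)) := by
  have hf : Measurable fun v : EuclideanSpace ℝ (Fin p) × EuclideanSpace ℝ (Fin q) =>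
      euclMul P₁ v.1 + euclMul P₂ v.2 := by fun_prop
  have hg : Measurable fun v : EuclideanSpace ℝ (Fin p) × EuclideanSpace ℝ (Fin q) =>
      euclMul Q₁ v.1 + euclMul Q₂ v.2 := by fun_prop
  have : IsProbabilityMeasure
      (((stdGaussian (EuclideanSpace ℝ (Fin p))).prod
        (stdGaussian (EuclideanSpace ℝ (Fin q)))).map
      (fun v => (euclMul P₁ v.1 + euclMul P₂ v.2, euclMul Q₁ v.1 + euclMul Q₂ v.2))) :=
    Measure.isProbabilityMeasure_map (hf.prodMk hg).aemeasurable
  rw [← charFun_eq_prod_iff]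
  intro t
  obtain ⟨a, ha⟩ : ∃ a, a = t.ofLp.1 := ⟨_, rfl⟩
  obtain ⟨b, hb⟩ : ∃ b, b = t.ofLp.2 := ⟨_, rfl⟩
  have hL : charFun ((((stdGaussian (EuclideanSpace ℝ (Fin p))).prod
        (stdGaussian (EuclideanSpace ℝ (Fin q)))).map
      (fun v => (euclMul P₁ v.1 + euclMul P₂ v.2, euclMul Q₁ v.1 + euclMul Q₂ v.2))).map
        (WithLp.toLp 2)) t =
      charFun (stdGaussian (EuclideanSpace ℝ (Fin p))) (euclMul P₁ᵀ a + euclMul Q₁ᵀ b) *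
      charFun (stdGaussian (EuclideanSpace ℝ (Fin q))) (euclMul P₂ᵀ a + euclMul Q₂ᵀ b) := by
    rw [charFun_map_toLp_prodMk _ hf hg, ← ha, ← hb, charFun_apply,
      charFun_apply, ← integral_prod_mul]
    congr 1 with v
    rw [← Complex.exp_add, ← add_mul, ← Complex.ofReal_add]
    simp only [inner_add_left, inner_add_right, inner_euclMul_left]
    congr 3
    ring
  rw [hL, ← ha, ← hb, charFun_stdGaussian, charFun_stdGaussian,
    charFun_multivariateGaussian ((posSemidef_self_mul_transpose P₁).add
      (posSemidef_self_mul_transpose P₂)),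
    charFun_multivariateGaussian ((posSemidef_self_mul_transpose Q₁).add
      (posSemidef_self_mul_transpose Q₂)), inner_zero_right, inner_zero_right, add_mulVec,
    add_mulVec, dotProduct_add, dotProduct_add, ← norm_euclMul_transpose_sq,
    ← norm_euclMul_transpose_sq, ← norm_euclMul_transpose_sq, ← norm_euclMul_transpose_sq,
    ← Complex.exp_add, ← Complex.exp_add, ← Complex.ofReal_pow, ← Complex.ofReal_pow,
    norm_add_sq_real, norm_add_sq_real]
  -- The cross terms sum to `⟨a, (P₁Q₁' + P₂Q₂')b⟩`, which vanishes by hypothesis, so the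
  -- characteristic function factors.
  have hcross : inner ℝ (euclMul P₁ᵀ a) (euclMul Q₁ᵀ b) +
      inner ℝ (euclMul P₂ᵀ a) (euclMul Q₂ᵀ b) = 0 := by
    rw [inner_euclMul_left, inner_euclMul_left, transpose_transpose, transpose_transpose,
      ← euclMul_mul, ← euclMul_mul, ← inner_add_right]
    have : euclMul (P₁ * Q₁ᵀ) b + euclMul (P₂ * Q₂ᵀ) b = euclMul (P₁ * Q₁ᵀ + P₂ * Q₂ᵀ) b := by
      simp only [euclMul_apply, add_mulVec, WithLp.toLp_add]
    rw [this, h, euclMul_apply, zero_mulVec, WithLp.toLp_zero, inner_zero_right]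
  congr 1
  push_cast
  have hc : ((inner ℝ (euclMul P₁ᵀ a) (euclMul Q₁ᵀ b) : ℝ) : ℂ) =
      -((inner ℝ (euclMul P₂ᵀ a) (euclMul Q₂ᵀ b) : ℝ) : ℂ) := by
    rw [← Complex.ofReal_neg]; congr 1; linarith
  rw [hc]
  ring

/-- Bayes bound for estimating a location `w` independent of the observation `z`. -/
theorem lintegral_location_le {E F : Type*} [MeasurableSpace F] [MeasurableSpace E] [AddCommGroup E]
    [MeasurableSub₂ E] {μW : Measure E} {μZ : Measure F} [IsProbabilityMeasure μW]
    [IsProbabilityMeasure μZ] (τ : Kernel F E) [IsMarkovKernel τ] {g : F → E} (hg : Measurable g)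
    {G : Set E} (hG : MeasurableSet G) {p : ENNReal} (hp : ∀ a, μW {w | a - w ∈ G} ≤ p) :
    ∫⁻ v, τ v.2 {y | y - g v.2 - v.1 ∈ G} ∂(μW.prod μZ) ≤ p := by
  have hset : MeasurableSet {u : (E × F) × E | u.2 - g u.1.2 - u.1.1 ∈ G} :=
    hG.preimage (by fun_prop)
  have hm : Measurable fun v : E × F => τ v.2 {y | y - g v.2 - v.1 ∈ G} :=
    Kernel.measurable_kernel_prodMk_left (κ := Kernel.prodMkLeft E τ) hset
  rw [lintegral_prod_symm _ hm.aemeasurable]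
  calc ∫⁻ z, ∫⁻ w, τ z {y | y - g z - w ∈ G} ∂μW ∂μZ ≤ ∫⁻ _, p ∂μZ := by
        refine lintegral_mono fun z => ?_
        have hs : MeasurableSet {u : E × E | u.2 - g z - u.1 ∈ G} := hG.preimage (by fun_prop)
        -- Given `z`, the decision `y` is independent of `w`, so the integrals may be exchanged and
        -- `hp` applied with `y` fixed.
        calc ∫⁻ w, τ z {y | y - g z - w ∈ G} ∂μW
            = (μW.prod (τ z)) {u : E × E | u.2 - g z - u.1 ∈ G} := (Measure.prod_apply hs).symm
          _ = ∫⁻ y, μW {w | y - g z - w ∈ G} ∂τ z := Measure.prod_apply_symm hs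
          _ ≤ ∫⁻ _, p ∂τ z := lintegral_mono fun y => hp _
          _ = p := by simp
    _ = p := by simp

/-- The prior is the law of `κξ`, `ξ` standard Gaussian, and the observation is `z = J(κξ) + e`. The
target `C(κξ)` equals `cCz` plus a residual of covariance `c CC'` independent of `z`. The average
coverage is thus at most `p`, and some `x` does no better than average. -/
theorem exists_prior_bound {C : Matrix (Fin m) (Fin n) ℝ} {J : Matrix (Fin n) (Fin n) ℝ}
    (h1 : C * J = C) (h2 : J * Cᵀ = Cᵀ) {c : ℝ} (hc0 : 0 < c) (hc1 : c < 1)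
    (τ : Kernel (EuclideanSpace ℝ (Fin n)) (EuclideanSpace ℝ (Fin m))) [IsMarkovKernel τ]
    {G : Set (EuclideanSpace ℝ (Fin m))} (hG : MeasurableSet G) {p : ENNReal}
    (hp : ∀ a, multivariateGaussian 0 (c • (C * Cᵀ)) {w | a - w ∈ G} ≤ p) :
    ∃ x : EuclideanSpace ℝ (Fin n),
      ∫⁻ e, τ (euclMul J x + e) {y | y - euclMul C x ∈ G}
        ∂stdGaussian (EuclideanSpace ℝ (Fin n)) ≤ p := by
  -- This scale makes `c = κ² / (1 + κ²)`, the shrinkage factor of the posterior mean.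
  obtain ⟨κ, hκ⟩ : ∃ κ, κ = √(c / (1 - c)) := ⟨_, rfl⟩
  have hc1' : (1 - c) ≠ 0 := by linarith
  have hκ2 : (1 - c) * κ ^ 2 = c := by
    rw [hκ, Real.sq_sqrt (div_nonneg hc0.le (by linarith))]; field_simp
  have hCJt : C * Jᵀ = C := by
    rw [← transpose_transpose (C * Jᵀ), transpose_mul, transpose_transpose, h2, transpose_transpose]
  have hind := map_prodMk_eq_prod (((1 - c) * κ) • C) ((-c) • C) (κ • J)
    (1 : Matrix (Fin n) (Fin n) ℝ) (by
      rw [transpose_smul, Matrix.smul_mul, Matrix.mul_smul, smul_smul, Matrix.smul_mul, hCJt,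
        transpose_one, Matrix.mul_one, ← add_smul,
        show (1 - c) * κ * κ + -c = 0 by linear_combination hκ2, zero_smul])
  have hcov : ((1 - c) * κ) • C * (((1 - c) * κ) • C)ᵀ + (-c) • C * ((-c) • C)ᵀ =
      c • (C * Cᵀ) := by
    rw [transpose_smul, transpose_smul, Matrix.smul_mul, Matrix.mul_smul, smul_smul,
      Matrix.smul_mul, Matrix.mul_smul, smul_smul, ← add_smul]
    congr 1
    linear_combination (1 - c) * hκ2
  rw [hcov] at hind
  have hset : MeasurableSet {u : (EuclideanSpace ℝ (Fin m) × EuclideanSpace ℝ (Fin n)) ×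
      EuclideanSpace ℝ (Fin m) | u.2 - c • euclMul C u.1.2 - u.1.1 ∈ G} :=
    hG.preimage (by fun_prop)
  have hm : Measurable fun v : EuclideanSpace ℝ (Fin m) × EuclideanSpace ℝ (Fin n) =>
      τ v.2 {y | y - c • euclMul C v.2 - v.1 ∈ G} :=
    Kernel.measurable_kernel_prodMk_left
      (κ := Kernel.prodMkLeft (EuclideanSpace ℝ (Fin m)) τ) hset
  have hle := lintegral_location_le
    (μZ := multivariateGaussian 0 (κ • J * (κ • J)ᵀ + 1 * (1 : Matrix (Fin n) (Fin n) ℝ)ᵀ))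
    τ (g := fun z => c • euclMul C z) (by fun_prop) hG hp
  let f : EuclideanSpace ℝ (Fin n) × EuclideanSpace ℝ (Fin n) → ENNReal := fun v =>
    τ (euclMul (κ • J) v.1 + euclMul 1 v.2) {y | y - c • euclMul C
      (euclMul (κ • J) v.1 + euclMul 1 v.2) - (euclMul (((1 - c) * κ) • C) v.1 +
        euclMul ((-c) • C) v.2) ∈ G}
  have hf : Measurable f := hm.comp (by fun_prop :
    Measurable fun v : EuclideanSpace ℝ (Fin n) × EuclideanSpace ℝ (Fin n) =>
      (euclMul (((1 - c) * κ) • C) v.1 + euclMul ((-c) • C) v.2,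
        euclMul (κ • J) v.1 + euclMul 1 v.2))
  rw [← hind, lintegral_map hm (by fun_prop)] at hle
  change ∫⁻ v, f v ∂_ ≤ p at hle
  rw [lintegral_prod _ hf.aemeasurable] at hle
  obtain ⟨x, hx⟩ := exists_le_lintegral (μ := stdGaussian (EuclideanSpace ℝ (Fin n)))
    (f := fun x => ∫⁻ e, f (x, e) ∂stdGaussian (EuclideanSpace ℝ (Fin n)))
    (Measurable.lintegral_prod_right' hf).aemeasurable
  refine ⟨κ • x, le_trans (le_of_eq ?_) (hx.trans hle)⟩
  congr 1 with e
  have e1 : euclMul J (κ • x) + e = euclMul (κ • J) x + euclMul 1 e := by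
    rw [map_smul, euclMul_smul, euclMul_one]
  have e2 : c • euclMul C (euclMul (κ • J) x + euclMul 1 e) + (euclMul (((1 - c) * κ) • C) x +
      euclMul ((-c) • C) e) = euclMul C (κ • x) := by
    rw [map_add, euclMul_one, euclMul_smul, map_smul, ← euclMul_mul, h1, euclMul_smul,
      euclMul_smul, map_smul]
    module
  simp only [f]
  rw [e1, ← e2]
  simp only [sub_sub]

/-- As `c` increases to `1` the sets decrease to the limiting ellipsoid; continuity of the measure
from above applies. -/
theorem le_of_forall_contraction {t : Fin m → ℝ} {r x : ℝ}
    (h : ∀ c : ℝ, 0 < c → c < 1 → x ≤ (piGaussian m).real {ξ | ∑ i, (√c * (t i * ξ i)) ^ 2 ≤ r}) :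
    x ≤ (piGaussian m).real {ξ | ∑ i, (t i * ξ i) ^ 2 ≤ r} := by
  let q : (Fin m → ℝ) → ℝ := fun ξ => ∑ i, (t i * ξ i) ^ 2
  have hq0 : ∀ ξ, 0 ≤ q ξ := fun ξ => Finset.sum_nonneg fun i _ => sq_nonneg _
  have hqm : Measurable q := by fun_prop
  -- The offset `2` keeps `c 0` positive.
  let c : ℕ → ℝ := fun j => 1 - 1 / ((j : ℝ) + 2)
  have hc0 : ∀ j, 0 < c j := fun j => by
    simp only [c, sub_pos]
    rw [div_lt_one (by positivity)]
    linarith [Nat.cast_nonneg (α := ℝ) j]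
  have hc1 : ∀ j, c j < 1 := fun j => by
    simp only [c, sub_lt_self_iff]; positivity
  have hclim : Filter.Tendsto c Filter.atTop (nhds 1) := by
    have h2 : Filter.Tendsto (fun j : ℕ => 1 / ((j : ℝ) + 2)) Filter.atTop (nhds 0) := by
      simp only [one_div]
      exact tendsto_inv_atTop_zero.comp
        (Filter.tendsto_atTop_add_const_right _ _ tendsto_natCast_atTop_atTop)
    simpa [c] using h2.const_sub 1
  have hcmono : Monotone c := fun i j hij => by
    simp only [c]
    gcongr
  let s : ℕ → Set (Fin m → ℝ) := fun j => {ξ | c j * q ξ ≤ r}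
  have hs : ∀ j, s j = {ξ | ∑ i, (√(c j) * (t i * ξ i)) ^ 2 ≤ r} := fun j => by
    ext ξ
    simp only [s, q, Set.mem_ofPred_eq, mul_pow _ (t _ * ξ _), Real.sq_sqrt (hc0 j).le,
      Finset.mul_sum]
  have hsm : ∀ j, MeasurableSet (s j) := fun j => measurableSet_le (by fun_prop) measurable_const
  have hanti : Antitone s := fun i j hij ξ hξ => by
    simp only [s, Set.mem_ofPred_eq] at hξ ⊢
    exact (mul_le_mul_of_nonneg_right (hcmono hij) (hq0 ξ)).trans hξ
  have hinter : ⋂ j, s j = {ξ | ∑ i, (t i * ξ i) ^ 2 ≤ r} := by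
    ext ξ
    simp only [Set.mem_iInter, s, Set.mem_ofPred_eq]
    constructor
    · intro hξ
      have : Filter.Tendsto (fun j => c j * q ξ) Filter.atTop (nhds (1 * q ξ)) :=
        hclim.mul_const _
      rw [one_mul] at this
      exact le_of_tendsto' this hξ
    · intro hξ j
      exact (mul_le_of_le_one_left (hq0 ξ) (hc1 j).le).trans hξ
  have hlim := tendsto_measure_iInter_atTop (μ := piGaussian m)
    (fun j => (hsm j).nullMeasurableSet) hanti ⟨0, measure_ne_top _ _⟩
  rw [hinter] at hlim
  have hlim' := (ENNReal.tendsto_toReal (measure_ne_top _ _)).comp hlim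
  refine ge_of_tendsto' hlim' fun j => ?_
  have := h (c j) (hc0 j) (hc1 j)
  rw [← hs] at this
  exact this

end LowerBound

/-! ### Value of the deficiency -/

section Deficiency

open Matrix

variable {M n m : ℕ}

theorem codeMean_smul (A : Matrix (Fin M) (Fin n) ℝ) (σ : ℝ) {k : ℕ}
    (K : Matrix (Fin M) (Fin k) ℝ) (x : EuclideanSpace ℝ (Fin k)) :
    codeMean A (σ • K *ᵥ x.ofLp) = σ • euclMul (Aᵀ * K) x := by
  rw [codeMean, mulVec_smul, mulVec_mulVec, euclMul_apply, WithLp.toLp_smul]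

theorem risk_one_sub_two_mul_indicator {Θ X D : Type*} [MeasurableSpace X] [MeasurableSpace D]
    (E : Experiment Θ X) (T : Θ → Set D) (hT : ∀ θ, MeasurableSet (T θ)) (κ : Kernel X D)
    [IsMarkovKernel κ] (θ : Θ) :
    risk E (fun θ y => 1 - 2 * (T θ).indicator 1 y) κ θ =
      1 - 2 * (∫⁻ x, κ x (T θ) ∂E.law θ).toReal := by
  have := E.isProbabilityMeasure θ
  have hm : Measurable fun x => κ x (T θ) := κ.measurable_coe (hT θ)
  have hi : Integrable (fun x => (κ x).real (T θ)) (E.law θ) :=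
    Integrable.of_bound hm.ennreal_toReal.aestronglyMeasurable 1 (ae_of_all _ fun x => by
      rw [Real.norm_eq_abs, abs_of_nonneg measureReal_nonneg]; exact measureReal_le_one)
  have h1 : ∀ x, ∫ y, (1 - 2 * (T θ).indicator 1 y) ∂κ x = 1 - 2 * (κ x).real (T θ) := fun x => by
    have hi' : Integrable ((T θ).indicator (1 : D → ℝ)) (κ x) :=
      (integrable_const (1 : ℝ)).indicator (hT θ)
    rw [integral_sub (integrable_const _) (hi'.const_mul 2), integral_const_mul,
      integral_indicator_one (hT θ), integral_const, probReal_univ, one_smul]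
  rw [risk]
  simp only [h1]
  rw [integral_sub (integrable_const _) (hi.const_mul 2), integral_const_mul, integral_const,
    probReal_univ, one_smul, ← integral_toReal hm.aemeasurable
      (ae_of_all _ fun x => measure_lt_top _ _)]
  rfl

theorem tvNorm_le_of_isDeficient {A : Matrix (Fin M) (Fin n) ℝ} {B : Matrix (Fin M) (Fin m) ℝ}
    (hB : A * Aᵀ * (pinv (A * Aᵀ) * B) = B) {σ ε : ℝ} (hσ : 0 < σ) (hε : 0 ≤ ε)
    (h : IsDeficient (fun _ => ε) (codeExperiment A σ) (codeExperiment B σ)) :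
    tvNorm (multivariateGaussian 0 (supOne (linkMatrix A B * (linkMatrix A B)ᵀ)))
      (multivariateGaussian 0 (1 : Matrix (Fin m) (Fin m) ℝ)) ≤ ε := by
  obtain ⟨C, hC⟩ : ∃ C, C = linkMatrix A B := ⟨_, rfl⟩
  obtain ⟨K, hK⟩ : ∃ K, K = pinv (A * Aᵀ) * A := ⟨_, rfl⟩
  have hCA : C * Aᵀ = Bᵀ := hC ▸ linkMatrix_mul_transpose hB
  have hBK : Bᵀ * K = C := by rw [hK, hC]; exact linkMatrix_mul_proj hB
  have hCJ : C * (Aᵀ * K) = C := by rw [← Matrix.mul_assoc, hCA, hBK]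
  have hJC : Aᵀ * K * Cᵀ = Cᵀ := by
    have hCt : Cᵀ = Aᵀ * (pinv (A * Aᵀ) * B) := by
      rw [hC, linkMatrix, transpose_mul, transpose_transpose]
    conv_rhs => rw [hCt, ← hB]
    rw [hCt, hK]
    simp only [Matrix.mul_assoc]
  rw [← hC]
  obtain ⟨U, l, hU, hU', hl, hS, hsup⟩ := exists_diagonalization (posSemidef_self_mul_transpose C)
  let s : Fin m → ℝ := fun i => √(max (l i) 1)
  have hs2 : ∀ i, s i ^ 2 = max (l i) 1 := fun i => Real.sq_sqrt (le_max_of_le_right zero_le_one)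
  have hs1 : ∀ i, 1 ≤ s i := fun i => Real.one_le_sqrt.2 (le_max_right _ _)
  have hsup' : supOne (C * Cᵀ) = U * diagonal (fun i => s i ^ 2) * Uᵀ := by
    rw [hsup]; simp only [hs2]
  let G := rotatedRegion U s
  have hG : MeasurableSet G := measurableSet_rotatedRegion U s
  let T : (Fin M → ℝ) → Set (EuclideanSpace ℝ (Fin m)) := fun β =>
    {y | σ⁻¹ • y - σ⁻¹ • codeMean B β ∈ G}
  have hT : ∀ β, MeasurableSet (T β) := fun β => hG.preimage
    (by fun_prop : Measurable fun y : EuclideanSpace ℝ (Fin m) => σ⁻¹ • y - σ⁻¹ • codeMean B β)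
  -- Values `±1` rather than `0, 1`: the risk then varies by twice the coverage while `|L| ≤ 1`,
  -- matching the factor `2` in the total variation norm.
  let L : (Fin M → ℝ) → EuclideanSpace ℝ (Fin m) → ℝ := fun β y => 1 - 2 * (T β).indicator 1 y
  have hL1 : ∀ β y, |L β y| ≤ 1 := fun β y => by
    by_cases hy : y ∈ T β
    · simp only [L, Set.indicator_of_mem hy, Pi.one_apply]; norm_num
    · simp only [L, Set.indicator_of_notMem hy]; norm_num
  obtain ⟨τ, hτ, hr⟩ := h Set.univ (EuclideanSpace ℝ (Fin m)) L
    (fun β => measurable_const.sub ((measurable_one.indicator (hT β)).const_mul 2))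
    (fun β => ⟨1, by rintro _ ⟨y, rfl⟩; exact hL1 β y⟩) Kernel.id inferInstance
  have hid : ∀ β, (∫⁻ x, (Kernel.id : Kernel (EuclideanSpace ℝ (Fin m))
      (EuclideanSpace ℝ (Fin m))) x (T β)
      ∂(codeExperiment B σ).law β).toReal =
      (multivariateGaussian 0 (1 : Matrix (Fin m) (Fin m) ℝ)).real G := by
    intro β
    have hd : ∀ x, (Kernel.id : Kernel (EuclideanSpace ℝ (Fin m)) (EuclideanSpace ℝ (Fin m))) x
        (T β) = (T β).indicator 1 x := fun x => by
      rw [Kernel.id_apply, Measure.dirac_apply' _ (hT β)]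
    simp only [hd]
    rw [lintegral_indicator_one (hT β), codeExperiment_law, Measure.map_apply (by fun_prop) (hT β),
      multivariateGaussian_zero_one, measureReal_def]
    congr 2 with x
    simp only [T, Set.mem_preimage, Set.mem_ofPred_eq, smul_add, smul_smul,
      inv_mul_cancel₀ hσ.ne', one_smul, add_sub_cancel_left]
  have hbound : ∀ β, (multivariateGaussian 0 (1 : Matrix (Fin m) (Fin m) ℝ)).real G - ε / 2 ≤
      (∫⁻ x, τ x (T β) ∂(codeExperiment A σ).law β).toReal := by
    intro β
    have h1 := hr β (Set.mem_univ _)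
    rw [risk_one_sub_two_mul_indicator _ _ hT, risk_one_sub_two_mul_indicator _ _ hT, hid] at h1
    have h2 : ⨆ y, |L β y| ≤ 1 := ciSup_le fun y => hL1 β y
    nlinarith
  have hkey : (multivariateGaussian 0 (1 : Matrix (Fin m) (Fin m) ℝ)).real G - ε / 2 ≤
      (piGaussian m).real {ξ | ∑ i, (√(1 - 1 / s i ^ 2) * √(l i) * ξ i) ^ 2 ≤
        2 * ∑ i, Real.log (s i)} := by
    refine le_of_forall_contraction fun c hc0 hc1 => ?_
    -- The problem is rescaled to unit noise variance.
    let τ' : Kernel (EuclideanSpace ℝ (Fin n)) (EuclideanSpace ℝ (Fin m)) :=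
      (τ.comap (fun x => σ • x) (by fun_prop)).map fun y => σ⁻¹ • y
    have : IsMarkovKernel τ' := Kernel.IsMarkovKernel.map _ (by fun_prop)
    have hcS : c • (C * Cᵀ) = U * diagonal (fun i => (√c * √(l i)) ^ 2) * Uᵀ := by
      rw [hS, ← Matrix.smul_mul, ← Matrix.mul_smul, ← diagonal_smul]
      congr 3
      funext i
      rw [mul_pow, Real.sq_sqrt hc0.le, Real.sq_sqrt (hl i)]
      rfl
    obtain ⟨x, hx⟩ := exists_prior_bound hCJ hJC hc0 hc1 τ' hG fun a => by
      rw [hcS]; exact multivariateGaussian_shift_le hU s _ a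
    refine (hbound (σ • K *ᵥ x.ofLp)).trans ?_
    have hTset : T (σ • K *ᵥ x.ofLp) = {y | σ⁻¹ • y - euclMul C x ∈ G} := by
      simp only [T, codeMean_smul, hBK, smul_smul, inv_mul_cancel₀ hσ.ne', one_smul]
    have hGx : MeasurableSet {y | y - euclMul C x ∈ G} :=
      hG.preimage (by fun_prop : Measurable fun y => y - euclMul C x)
    have hint : ∫⁻ z, τ z (T (σ • K *ᵥ x.ofLp)) ∂(codeExperiment A σ).law (σ • K *ᵥ x.ofLp) =
        ∫⁻ e, τ' (euclMul (Aᵀ * K) x + e) {y | y - euclMul C x ∈ G}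
          ∂stdGaussian (EuclideanSpace ℝ (Fin n)) := by
      rw [codeExperiment_law, lintegral_map (τ.measurable_coe (hT _)) (by fun_prop)]
      congr 1 with e
      rw [Kernel.map_apply' _ (by fun_prop) _ hGx, Kernel.comap_apply, codeMean_smul, ← smul_add,
        hTset]
      rfl
    rw [hint, measureReal_def]
    refine ENNReal.toReal_mono (measure_ne_top _ _) (hx.trans (le_of_eq ?_))
    congr! 6 with ξ i
    ring
  have hpG : (multivariateGaussian 0 (supOne (C * Cᵀ))).real G =
      (piGaussian m).real {ξ | ∑ i, (√(1 - 1 / s i ^ 2) * √(l i) * ξ i) ^ 2 ≤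
        2 * ∑ i, Real.log (s i)} := by
    rw [hsup', ← piGaussian_map_euclMul, measureReal_def, measureReal_def,
      Measure.map_apply (by fun_prop) hG]
    congr 2 with ξ
    rw [Set.mem_preimage, mem_rotatedRegion_iff hU, densityRegion, Set.mem_ofPred_eq,
      Set.mem_ofPred_eq]
    refine Eq.to_iff (congrArg (· ≤ _) (Finset.sum_congr rfl fun i _ => ?_))
    -- If `l i ≤ 1` then `s i = 1` and the coefficient of this coordinate is `0`; otherwise `S` and
    -- `S ∨ I` have the same variance there.
    rcases le_total (l i) 1 with hli | hli
    · have : s i = 1 := by simp only [s, max_eq_right hli, Real.sqrt_one]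
      simp [this]
    · have : s i = √(l i) := by simp only [s, max_eq_left hli]
      simp only [this, mul_assoc]
  have htv := tvNorm_le_rotatedRegion hU hU' hs1
  rw [← hpG] at hkey
  simp only [← hsup'] at htv
  exact htv.trans (by linarith)

theorem deficiency_eq_tvNorm {A : Matrix (Fin M) (Fin n) ℝ} {B : Matrix (Fin M) (Fin m) ℝ}
    (hB : A * Aᵀ * (pinv (A * Aᵀ) * B) = B) {σ : ℝ} (hσ : 0 < σ) :
    deficiency (codeExperiment A σ) (codeExperiment B σ) =
      tvNorm (multivariateGaussian 0 (supOne (Bᵀ * pinv (A * Aᵀ) * B)))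
        (multivariateGaussian 0 (1 : Matrix (Fin m) (Fin m) ℝ)) := by
  simp only [← linkMatrix_mul_self_transpose hB]
  -- The infimum is attained, so decoders meet the deficiency itself without an added error.
  refine IsLeast.csInf_eq ⟨⟨tvNorm_nonneg _ _, isDeficient_tvNorm (linkMatrix_mul_transpose hB) σ⟩,
    fun ε hε => tvNorm_le_of_isDeficient hB hσ hε.1 hε.2⟩

theorem exists_decoder_le_deficiency (hn : 0 < n) {A : Matrix (Fin M) (Fin n) ℝ}
    {B : Matrix (Fin M) (Fin m) ℝ} (hB : A * Aᵀ * (pinv (A * Aᵀ) * B) = B) {σ : ℝ} (hσ : 0 < σ)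
    {dB : EuclideanSpace ℝ (Fin m) → Fin M} (hdB : Measurable dB) :
    ∃ dA : EuclideanSpace ℝ (Fin n) → Fin M, Measurable dA ∧
      ∀ i, packetErrorProb A σ dA i - packetErrorProb B σ dB i ≤
        deficiency (codeExperiment A σ) (codeExperiment B σ) := by
  rw [deficiency_eq_tvNorm hB hσ]
  refine exists_decoder_of_isDeficient hn hσ (tvNorm_nonneg _ _) ?_ hdB
  simp only [← linkMatrix_mul_self_transpose hB]
  exact isDeficient_tvNorm (linkMatrix_mul_transpose hB) σ

end Deficiency

end CodeComparison

theorem mainTheorem1 {M n m : ℕ} (hn : 0 < n)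
    (A : Matrix (Fin M) (Fin n) ℝ) (B : Matrix (Fin M) (Fin m) ℝ) (σ : ℝ) (hσ : 0 < σ) :
    ((A * A.transpose - B * B.transpose).PosSemidef →
      ∀ dB : EuclideanSpace ℝ (Fin m) → Fin M, Measurable dB →
        ∃ dA : EuclideanSpace ℝ (Fin n) → Fin M, Measurable dA ∧
          ∀ i : Fin M, CodeComparison.packetErrorProb A σ dA i ≤
            CodeComparison.packetErrorProb B σ dB i) ∧
    (LinearMap.range B.mulVecLin ≤ LinearMap.range A.mulVecLin →
      (∀ dB : EuclideanSpace ℝ (Fin m) → Fin M, Measurable dB →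
        ∃ dA : EuclideanSpace ℝ (Fin n) → Fin M, Measurable dA ∧
          ∀ i : Fin M, CodeComparison.packetErrorProb A σ dA i -
              CodeComparison.packetErrorProb B σ dB i ≤
            CodeComparison.deficiency (CodeComparison.codeExperiment A σ)
              (CodeComparison.codeExperiment B σ)) ∧
      CodeComparison.deficiency (CodeComparison.codeExperiment A σ)
          (CodeComparison.codeExperiment B σ) =
        CodeComparison.tvNorm
          (multivariateGaussian 0 (CodeComparison.supOne
            (B.transpose * CodeComparison.pinv (A * A.transpose) * B)))
          (multivariateGaussian 0 (1 : Matrix (Fin m) (Fin m) ℝ))) := by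
  refine ⟨fun h dB hdB => ?_, fun h => ?_⟩
  · have hB := CodeComparison.mul_pinv_mul_cancel_of_posSemidef h
    obtain ⟨dA, hdA, hle⟩ := CodeComparison.exists_decoder_le_deficiency hn hB hσ hdB
    refine ⟨dA, hdA, fun i => sub_nonpos.1 ((hle i).trans_eq ?_)⟩
    rw [CodeComparison.deficiency_eq_tvNorm hB hσ]
    simp only [CodeComparison.supOne_eq_one_of_posSemidef h]
    exact CodeComparison.tvNorm_self _
  · have hB := CodeComparison.mul_pinv_mul_cancel_of_range_le h
    exact ⟨fun dB hdB => CodeComparison.exists_decoder_le_deficiency hn hB hσ hdB,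
      CodeComparison.deficiency_eq_tvNorm hB hσ⟩
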